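/- **Notation.** Let $R$ be a commutative $\mathbb{Q}$-algebra (for example $\mathbb{C}$ or $\mathbb{C}[x_1^{\pm1},\dots,x_N^{\pm1}]$), let $l,N,K\ge 0$ be integers, let $x=(x_1,\dots,x_N)$ be units of $R$, and let $y=(y_1,\dots,y_K)$ be formal variables. A *generalized partition* with $n$ entries is a sequence $\lambda=(\lambda_1\ge\dots\ge\lambda_n\ge 0)$ of integers (zeros allowed). Define $h_n(x^\pm)\in R$ and $f_n(y)\in R[[y_1,\dots,y_K]]$, $n\in\mathbb{Z}$, by $$\prod_{i=1}^N\frac1{(1-x_iz)(1-x_i^{-1}z)}=\sum_{n\in\mathbb{Z}}h_n(x^\pm)z^n,\qquad \prod_{j=1}^K\frac1{(1-y_jz)(1-y_jz^{-1})}=\sum_{n\in\mathbb{Z}}f_n(y)z^n,$$ expanded in powers of $z$ (so $h_n=0$ for $n<0$) and in powers of the $y_j$, respectively. For generalized partitions $\lambda=(\lambda_1,\dots,\lambda_{l+N})$ and $\mu=(\mu_1,\dots,\mu_l)$ the skew odd orthogonal character is $so_{\lambda/\mu}(x^\pm)=\det(a_{ij})_{1\le i,j\le l+N}$ with $$a_{ij}=h_{\lambda_i-\mu_j-i+j}(x^\pm)\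 \ (1\le j\le l),\qquad a_{ij}=h_{\lambda_i-i+j}(x^\pm)+h_{\lambda_i-i-j+2l+1}(x^\pm)\ \ (l+1\le j\le l+N).$$ For generalized partitions $\mu,\nu$ with the same number $n$ of entries, $$SO^*_{\mu/\nu}(y)=\det\left(f_{\nu_i-\mu_j-i+j}(y)-f_{\nu_i+\mu_j-i-j+2n+1}(y)\right)_{1\le i,j\le n}.$$ Let $\mathcal{M}=R[a_{-1},a_{-2},\dots]\,|0\rangle$ be the Fock space of the Heisenberg algebra $[a_m,a_n]=m\delta_{m,-n}$, where $a_{-n}$ ($n\ge1$) acts by multiplication and $a_n=n\,\partial/\partial a_{-n}$; let $\langle 0|$ be the constant-term functional. Put $$U(z)=(1+z)\,e^{\sum_{n\ge1}\frac{a_{-n}}n z^n}e^{-\sum_{n\ge1}\frac{a_n}n(z^n+z^{-n})}=\sum_n U_nz^{-n},\qquad U^*(z)=(1-z)\,e^{-\sum_{n\ge1}\frac{a_{-n}}n z^n}e^{\sum_{n\ge1}\frac{a_n}n(z^n+z^{-n})}=\sum_n U^*_nz^{n},$$ $$|\lambda^{so}\rangle=U_{-\lambda_1}\cdots U_{-\lambda_n}|0\rangle,\qquad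 \langle\lambda^{so}|=\langle0|U^*_{-\lambda_n}\cdots U^*_{-\lambda_1}\qquad\text{for }\lambda=(\lambda_1,\dots,\lambda_n),$$ and $\Gamma_\pm(z)=\exp\left(\sum_{n\ge1}\frac{a_{\pm n}}nz^n\right)$, $\Gamma_+(x^\pm)=\prod_{i=1}^N\Gamma_+(x_i)\Gamma_+(x_i^{-1})$, $\Gamma_-(y)=\prod_{j=1}^K\Gamma_-(y_j)$. **Theorem.** (a) For all generalized partitions $\lambda$ with $l+N$ entries and $\mu$ with $l$ entries, $\langle\mu^{so}|\Gamma_+(x^\pm)|\lambda^{so}\rangle=so_{\lambda/\mu}(x^\pm)$. For all generalized partitions $\mu,\nu$ with the same number of entries, $\langle\mu^{so}|\Gamma_-(y)|\nu^{so}\rangle=SO^*_{\mu/\nu}(y)$ in $R[[y_1,\dots,y_K]]$. (b) For all generalized partitions $\mu=(\mu_1,\dots,\mu_l)$ and $\lambda=(\lambda_1,\dots,\lambda_{l+N})$, in $R[[y_1,\dots,y_K]]$, $$\sum_{\rho=(\rho_1,\dots,\rho_{l+N})}so_{\rho/\mu}(x^\pm)\,SO^*_{\rho/\lambda}(y)=\prod_{i=1}^N\prod_{j=1}^K\frac1{(1-x_iy_j)(1-x_i^{-1}y_j)}\sum_{\tau=(\tau_1,\dots,\tau_l)}so_{\lambda/\tau}(x^\pm)\,SO^*_{\mu/\tau}(y),$$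 where the sums run over all generalized partitions with $l+N$ and with $l$ entries, respectively; in both sums each coefficient of a monomial in $y$ receives only finitely many nonzero contributions. -/

import Mathlib

open scoped LaurentPolynomial

noncomputable section

namespace OddOrth

/-! ### Generalized partitions and the two families of determinants -/

/-- Generalized partitions `(lam_1 ≥ ... ≥ lam_n ≥ 0)` with exactly `n` entries (zeros allowed). -/
abbrev GenPartition (n : ℕ) : Type := {p : Fin n → ℕ // Antitone p}

/-- The power series `∏_i 1 / ((1 - x_i z) (1 - x_i⁻¹ z))` in `z`. -/
def hSeries {R : Type*} [CommRing R] {N : ℕ} (x : Fin N → Rˣ) : PowerSeries R :=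
  ∏ i, (PowerSeries.invOfUnit (1 - PowerSeries.C (x i : R) * PowerSeries.X) 1 *
    PowerSeries.invOfUnit (1 - PowerSeries.C (((x i)⁻¹ : Rˣ) : R) * PowerSeries.X) 1)

/-- `h_n(x^±)`, the coefficient of `z ^ n` in `hSeries x`; it is zero for `n < 0`. -/
def hPM {R : Type*} [CommRing R] {N : ℕ} (x : Fin N → Rˣ) (n : ℤ) : R :=
  if 0 ≤ n then PowerSeries.coeff n.toNat (hSeries x) else 0

/-- The skew odd orthogonal character `so_{lam/mu}(x^±)` as an `(l + N) × (l + N)` determinant.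
`Fin` counts from zero, so the `i`-th row in the usual numbering is `(i : ℤ) + 1`. -/
def skewSO {R : Type*} [CommRing R] {l N : ℕ} (x : Fin N → Rˣ)
    (lam : GenPartition (l + N)) (mu : GenPartition l) : R :=
  Matrix.det (Matrix.of fun i j : Fin (l + N) =>
    if hj : (j : ℕ) < l then
      hPM x ((lam.1 i : ℤ) - (mu.1 ⟨j, hj⟩ : ℤ) - ((i : ℤ) + 1) + ((j : ℤ) + 1))
    else
      hPM x ((lam.1 i : ℤ) - ((i : ℤ) + 1) + ((j : ℤ) + 1)) +
        hPM x ((lam.1 i : ℤ) - ((i : ℤ) + 1) - ((j : ℤ) + 1) + 2 * (l : ℤ) + 1))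

/-- `∏_j 1 / ((1 - y_j z) (1 - y_j z⁻¹))`, as a power series in `y_1, ..., y_K` whose coefficients
are Laurent polynomials in `z`. -/
def fSeries (R : Type*) [CommRing R] (K : ℕ) : MvPowerSeries (Fin K) R[T;T⁻¹] :=
  ∏ j, (MvPowerSeries.invOfUnit
      (1 - MvPowerSeries.C (LaurentPolynomial.T 1 : R[T;T⁻¹]) * MvPowerSeries.X j) 1 *
    MvPowerSeries.invOfUnit
      (1 - MvPowerSeries.C (LaurentPolynomial.T (-1) : R[T;T⁻¹]) * MvPowerSeries.X j) 1)

/-- `f_n(y)`, the coefficient of `z ^ n` in `fSeries R K`, a power series in `y_1, ..., y_K`. -/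
def fCoeff (R : Type*) [CommRing R] (K : ℕ) (n : ℤ) : MvPowerSeries (Fin K) R :=
  fun d => (MvPowerSeries.coeff d (fSeries R K)).coeff n

/-- `SO^*_{mu/nu}(y)` for generalized partitions `mu`, `nu` with `l` entries. -/
def dualSO (R : Type*) [CommRing R] (K : ℕ) {l : ℕ} (mu nu : GenPartition l) :
    MvPowerSeries (Fin K) R :=
  Matrix.det (Matrix.of fun i j : Fin l =>
    fCoeff R K ((nu.1 i : ℤ) - (mu.1 j : ℤ) - ((i : ℤ) + 1) + ((j : ℤ) + 1)) -
      fCoeff R K ((nu.1 i : ℤ) + (mu.1 j : ℤ) - ((i : ℤ) + 1) - ((j : ℤ) + 1)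
        + 2 * (l : ℤ) + 1))

/-- `∏_{i, j} 1 / ((1 - x_i y_j) (1 - x_i⁻¹ y_j))`, expanded as a power series in `y`. -/
def cauchyKernel {R : Type*} [CommRing R] {N : ℕ} (K : ℕ) (x : Fin N → Rˣ) :
    MvPowerSeries (Fin K) R :=
  ∏ i, ∏ j, (MvPowerSeries.invOfUnit (1 - MvPowerSeries.C (x i : R) * MvPowerSeries.X j) 1 *
    MvPowerSeries.invOfUnit
      (1 - MvPowerSeries.C (((x i)⁻¹ : Rˣ) : R) * MvPowerSeries.X j) 1)

/-- The (possibly infinite) family `F` of formal power series has the sum `S`: every coefficient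
receives only finitely many nonzero contributions, and these add up to the coefficient of `S`. -/
def HasFormalSum {R ι σ : Type*} [CommRing R] (F : ι → MvPowerSeries σ R)
    (S : MvPowerSeries σ R) : Prop :=
  ∀ d : σ →₀ ℕ, {a : ι | MvPowerSeries.coeff d (F a) ≠ 0}.Finite ∧
    ∑ᶠ a : ι, MvPowerSeries.coeff d (F a) = MvPowerSeries.coeff d S

/-! ### Fock space and vertex operators -/

/-- The Fock space of the Heisenberg algebra `[a_m, a_n] = m δ_{m,-n}`: polynomials in the creation
operators `X n = a_{-n}`, `n ≥ 1`, applied to the vacuum `1`. The operator `a_{-n}` acts as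
multiplication by `X n` and `a_n` as `n ∂/∂X_n`; the dual vacuum is the constant coefficient. -/
abbrev Fock (R : Type*) [CommRing R] : Type _ := MvPolynomial ℕ+ R

section Operators

variable {R : Type*} [CommRing R] [Algebra ℚ R]

/-- The power series `∑_{n ≥ 1} (a_{-n} / n) z ^ n`. -/
def creationSeries (R : Type*) [CommRing R] [Algebra ℚ R] : PowerSeries (Fock R) :=
  PowerSeries.mk fun n =>
    if hn : 0 < n then ((n : ℚ)⁻¹) • (MvPolynomial.X ⟨n, hn⟩ : Fock R) else 0

/-- Coefficient of `z ^ n` in `Γ_-(z) = exp (∑_{n ≥ 1} (a_{-n} / n) z ^ n)` (zero for `n < 0`),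
acting by multiplication. -/
def expCreation (R : Type*) [CommRing R] [Algebra ℚ R] (n : ℤ) : Fock R :=
  if 0 ≤ n then
    PowerSeries.coeff n.toNat ((PowerSeries.exp (Fock R)).subst (creationSeries R))
  else 0

/-- Coefficient of `z ^ n` in `exp (- ∑_{n ≥ 1} (a_{-n} / n) z ^ n)` (zero for `n < 0`). -/
def expNegCreation (R : Type*) [CommRing R] [Algebra ℚ R] (n : ℤ) : Fock R :=
  if 0 ≤ n then
    PowerSeries.coeff n.toNat ((PowerSeries.exp (Fock R)).subst (-creationSeries R))
  else 0

/-- `exp (∑_{n ≥ 1} (a_n / n) c_n)` on the Fock space. Since `a_n / n = ∂/∂X_n`, this is, by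
Taylor's formula, the translation `X_n ↦ X_n + c_n`. The `c_n` lie in a commutative `Fock R`-algebra
`B` (as the values `z ^ n + z ^ (-n)` do in the Laurent polynomials over `Fock R`) and
are understood to be constants, that is, not to involve the `X_n`. -/
def expAnnihilation {B : Type*} [CommRing B] [Algebra R B] [Algebra (Fock R) B]
    (c : ℕ+ → B) : Fock R →ₐ[R] B :=
  MvPolynomial.aeval fun n => algebraMap (Fock R) B (MvPolynomial.X n) + c n

/-- `z ^ n + z ^ (-n)`. -/
def zPM (R : Type*) [CommRing R] (n : ℕ+) : (Fock R)[T;T⁻¹] :=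
  LaurentPolynomial.T (n : ℤ) + LaurentPolynomial.T (-(n : ℤ))

/-- `U_n`, the coefficient of `z ^ (-n)` in
`U(z) = (1 + z) exp (∑ (a_{-k} / k) z ^ k) exp (- ∑ (a_k / k) (z ^ k + z ^ (-k)))`. -/
def vertexU (n : ℤ) (v : Fock R) : Fock R :=
  ((1 + LaurentPolynomial.T 1) * expAnnihilation (fun k => -zPM R k) v).coeff.sum
    fun i a => expCreation R (-n - i) * a

/-- `U^*_n`, the coefficient of `z ^ n` in
`U^*(z) = (1 - z) exp (- ∑ (a_{-k} / k) z ^ k) exp (∑ (a_k / k) (z ^ k + z ^ (-k)))`. -/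
def vertexUStar (n : ℤ) (v : Fock R) : Fock R :=
  ((1 - LaurentPolynomial.T 1) * expAnnihilation (fun k => zPM R k) v).coeff.sum
    fun i a => expNegCreation R (n - i) * a

/-- `|lam^so⟩ = U_{-lam_1} ⋯ U_{-lam_l} |0⟩`. -/
def ket {l : ℕ} (lam : GenPartition l) : Fock R :=
  (List.ofFn lam.1).foldr (fun m v => vertexU (-(m : ℤ)) v) 1

/-- The pairing of `⟨mu^so| = ⟨0| U^*_{-mu_l} ⋯ U^*_{-mu_1}` with a vector `v`. -/
def bra {l : ℕ} (mu : GenPartition l) (v : Fock R) : R :=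
  MvPolynomial.constantCoeff
    ((List.ofFn mu.1).foldl (fun w m => vertexUStar (-(m : ℤ)) w) v)

/-- `Γ_+(x^±) = ∏_i Γ_+(x_i) Γ_+(x_i⁻¹)` with `Γ_+(z) = exp (∑_{n ≥ 1} (a_n / n) z ^ n)`. -/
def gammaPlus {N : ℕ} (x : Fin N → Rˣ) : Fock R →ₐ[R] Fock R :=
  expAnnihilation fun n => MvPolynomial.C
    (∑ i, ((x i : R) ^ (n : ℕ) + (((x i)⁻¹ : Rˣ) : R) ^ (n : ℕ)))

/-- The matrix coefficient `⟨mu^so| Γ_+(x^±) |lam^so⟩`. -/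
def gammaPlusCoeff {l m N : ℕ} (x : Fin N → Rˣ) (mu : GenPartition l) (lam : GenPartition m) : R :=
  bra mu (gammaPlus x (ket lam))

/-- The matrix coefficient `⟨mu^so| Γ_-(y) |nu^so⟩`, `Γ_-(y) = ∏_j Γ_-(y_j)`, as a formal power
series in `y_1, ..., y_K`. -/
def gammaMinusCoeff (R : Type*) [CommRing R] [Algebra ℚ R] (K : ℕ) {l m : ℕ}
    (mu : GenPartition l) (nu : GenPartition m) : MvPowerSeries (Fin K) R :=
  fun d => bra mu ((∏ j, expCreation R (d j : ℤ)) * ket nu)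

end Operators

end OddOrth

end

/-! Kets are Jacobi–Trudi determinants. Each `U(z)` multiplies by a Γ_- series and translates the
variables, which multiplies every such series G(t) already present by (1 - zt)(1 - t/z). Applying
one more operator therefore amounts to adding one row to a determinant with entries G_{e+j} +
G_{e-1-j} (`ket_eq_det`).

Bras are coefficient extractions. Composing the translations in U^*(z_1), ..., U^*(z_l) and then
taking the constant term evaluates a vector at the power sums of z_1^±, ..., z_l^± (`evSym`); the
prefactors multiply to the Weyl denominator of type B, up to a monomial. So ⟨mu| v⟩ is the
coefficient of z^{-mu} in `weylDen * evSym v` (`bra_eq_coeff`).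

For (a), the denominator is absorbed into the determinant. The determinant depends only on
functionals of polynomials in z + z⁻¹, so its columns may be replaced by Lagrange products at the
cost of ∏_{i<j} (Z_i - Z_j), where Z_k = z_k + z_k⁻¹ (`diffProd_mul_det`). Column k < l then
involves z_k alone and the remaining columns are constant (`weylDen_mul_det`). The coefficient of a
monomial is thus taken column by column, which gives `skewSO`. With Γ_-(y), an extra factor ∏_k
f(z_k; y) appears and the same extraction gives `dualSO`.

For (b), Σ_rho |rho⟩⟨rho| is inserted into ⟨mu|Γ_+Γ_-|lam⟩ and into ⟨mu|Γ_-Γ_+|lam⟩, which differ by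
the Cauchy kernel. With a fixed number n of entries this sum is the identity only modulo the kernel
of `evSym` in n variables. Orthonormality is (a) with N = 0. Completeness follows because Weyl
denominator times `evSym u` is antisymmetric under the hyperoctahedral group, hence determined by
the coefficients that the bras read off (`evSym_eq_zero_of_bra`). The functionals used must kill
that kernel; for ⟨mu|Γ_+(x^±) with l + N variables they do, since Γ_+ specializes the last N
variables to x (`evSym_gammaPlus`). -/

noncomputable section

namespace OddOrth

/-! ### Determinants of functionals on polynomials, and Lagrange columns. -/

section Determinants

open Polynomial (X C)

variable {A : Type*} [CommRing A]

/-- A determinant of linear functionals at a monic family of polynomials of degrees `0, 1, …`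
does not depend on the family. -/
theorem det_apply_monic {m : ℕ} (ℓ : Fin m → Polynomial A →ₗ[A] A) (P : ℕ → Polynomial A)
    (hd : ∀ j, (P j).natDegree = j) (hm : ∀ j, (P j).Monic) :
    (Matrix.of fun i j : Fin m => ℓ i (P j)).det =
      (Matrix.of fun i j : Fin m => ℓ i (X ^ (j : ℕ))).det := by
  have h : (Matrix.of fun i j : Fin m => ℓ i (P j)) =
      (Matrix.of fun i j : Fin m => ℓ i (X ^ (j : ℕ))) *
        Matrix.of fun i j : Fin m => (P j).coeff i := by
    ext i j
    rw [Matrix.mul_apply, Matrix.of_apply]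
    conv_lhs => rw [(P j).as_sum_range' m (by rw [hd]; exact j.2)]
    rw [map_sum, Finset.sum_range]
    refine Finset.sum_congr rfl fun k _ => ?_
    rw [← Polynomial.C_mul_X_pow_eq_monomial, ← Polynomial.smul_eq_C_mul, map_smul]
    simp [mul_comm]
  rw [h, Matrix.det_mul, Matrix.det_matrixOfPolynomials (fun j : Fin m => P j) (fun j => hd j)
    (fun j => hm j), mul_one]

/-- The product `∏_{i < j < l} (Z_i - Z_j)`. -/
def diffProd (Z : ℕ → A) (l : ℕ) : A :=
  ∏ i ∈ Finset.range l, ∏ j ∈ Finset.Ico (i + 1) l, (Z i - Z j)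

theorem diffProd_succ (Z : ℕ → A) (l : ℕ) :
    diffProd Z (l + 1) =
      (∏ i ∈ Finset.range l, (Z 0 - Z (i + 1))) * diffProd (fun i => Z (i + 1)) l := by
  unfold diffProd
  rw [Finset.prod_range_succ', mul_comm]
  congr 1
  · rw [zero_add, Finset.range_eq_Ico, Finset.prod_Ico_add' (fun i => Z 0 - Z i) 0 l 1]
  · refine Finset.prod_congr rfl fun i _ => ?_
    rw [← Finset.prod_Ico_add' (fun j => Z (i + 1) - Z j) (i + 1) l 1]

/-- The Lagrange type family attached to the nodes `Z_0, …, Z_{l-1}`, continued by multiples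
of `∏ (X - Z_i)`. -/
def lagrangeFamily (Z : ℕ → A) (B : ℕ → Polynomial A) (l k : ℕ) : Polynomial A :=
  if k < l then ∏ i ∈ Finset.range l, (if i = k then 1 else X - C (Z i))
  else (∏ i ∈ Finset.range l, (X - C (Z i))) * B (k - l)

theorem lagrangeFamily_zero (Z : ℕ → A) (B : ℕ → Polynomial A) (l : ℕ) :
    lagrangeFamily Z B (l + 1) 0 = ∏ i ∈ Finset.range l, (X - C (Z (i + 1))) := by
  simp [lagrangeFamily, Finset.prod_range_succ']

theorem lagrangeFamily_succ (Z : ℕ → A) (B : ℕ → Polynomial A) (l k : ℕ) :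
    lagrangeFamily Z B (l + 1) (k + 1) =
      (X - C (Z 0)) * lagrangeFamily (fun i => Z (i + 1)) B l k := by
  unfold lagrangeFamily
  by_cases h : k < l
  · rw [if_pos h, if_pos (by omega), Finset.prod_range_succ', mul_comm]
    simp
  · rw [if_neg h, if_neg (by omega), Finset.prod_range_succ']
    simp only [Nat.add_sub_add_right]
    ring

/-- Division by X - z, with the quotient expanded in exactly the m powers that index the other
columns in `diffProd_mul_det`. -/
theorem exists_sub_eval_eq (q : Polynomial A) (z : A) (m l : ℕ) (hq : q.natDegree ≤ l)
    (hl : l ≤ m) : ∃ g : Fin m → A,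
      q = C (q.eval z) + ∑ k : Fin m, g k • ((X - C z) * X ^ (k : ℕ)) := by
  nontriviality A
  set G := q /ₘ (X - C z) with hG
  have hdiv : C (q.eval z) + (X - C z) * G = q := by
    rw [← Polynomial.modByMonic_X_sub_C_eq_C_eval]
    exact Polynomial.modByMonic_add_div q (X - C z)
  have hsum : G = ∑ k ∈ Finset.range m, Polynomial.monomial k (G.coeff k) := by
    rcases Nat.eq_zero_or_pos q.natDegree with h0 | h0
    · have : G = 0 := by
        rw [hG, Polynomial.divByMonic_eq_zero_iff (Polynomial.monic_X_sub_C z),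
          Polynomial.degree_X_sub_C, Polynomial.eq_C_of_natDegree_eq_zero h0]
        exact lt_of_le_of_lt Polynomial.degree_C_le (by norm_num)
      simp [this]
    · apply Polynomial.as_sum_range'
      rw [hG, Polynomial.natDegree_divByMonic _ (Polynomial.monic_X_sub_C z),
        Polynomial.natDegree_X_sub_C]
      omega
  refine ⟨fun k => G.coeff k, ?_⟩
  conv_lhs => rw [← hdiv, hsum, Finset.sum_range, Finset.mul_sum]
  congr 1
  refine Finset.sum_congr rfl fun k _ => ?_
  rw [← Polynomial.C_mul_X_pow_eq_monomial, Polynomial.smul_eq_C_mul]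
  ring

/-- Induction on the nodes. Modulo columns divisible by X - Z_0, the polynomial ∏_{i>0} (X - Z_i)
equals its value ∏_{i>0} (Z_0 - Z_i) at Z_0; the other columns carry the common factor X - Z_0,
which is moved into the functionals. -/
theorem diffProd_mul_det {m l : ℕ} (hl : l ≤ m) (Z : ℕ → A) (B : ℕ → Polynomial A)
    (hd : ∀ j, (B j).natDegree = j) (hm : ∀ j, (B j).Monic)
    (ℓ : Fin m → Polynomial A →ₗ[A] A) :
    diffProd Z l * (Matrix.of fun i j : Fin m => ℓ i (X ^ (j : ℕ))).det =
      (Matrix.of fun i j : Fin m => ℓ i (lagrangeFamily Z B l j)).det := by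
  nontriviality A
  induction l generalizing m Z with
  | zero =>
    rw [← det_apply_monic ℓ B hd hm]
    simp [diffProd, lagrangeFamily]
  | succ l ih =>
    obtain ⟨m, rfl⟩ : ∃ m', m = m' + 1 := ⟨m - 1, by omega⟩
    have hl' : l ≤ m := by omega
    let ℓ' : Fin (m + 1) → Polynomial A →ₗ[A] A := fun i =>
      (ℓ i).comp (LinearMap.mulLeft A (X - C (Z 0)))
    let M : Polynomial A → Matrix (Fin (m + 1)) (Fin (m + 1)) A := fun p =>
      Matrix.of fun i j => Fin.cons (α := fun _ => A) (ℓ i p)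
        (fun j : Fin m => ℓ' i (X ^ (j : ℕ))) j
    -- The determinant with first column p and further columns (X - Z_0) X^k, as a linear function
    -- of p through its Laplace expansion.
    let φ : Polynomial A →ₗ[A] A := ∑ i : Fin (m + 1), (((-1) ^ (i : ℕ) *
      (Matrix.of fun (i' j : Fin m) => ℓ' (i.succAbove i') (X ^ (j : ℕ))).det) • ℓ i)
    have hM : ∀ p, (M p).det = φ p := by
      intro p
      rw [Matrix.det_succ_column_zero]
      simp only [φ, LinearMap.sum_apply, LinearMap.smul_apply, smul_eq_mul]
      refine Finset.sum_congr rfl fun i _ => ?_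
      have : (M p).submatrix i.succAbove Fin.succ =
          Matrix.of fun (i' j : Fin m) => ℓ' (i.succAbove i') (X ^ (j : ℕ)) := by
        ext i' j; simp [M]
      rw [this]
      simp [M]
      ring
    have hφ : ∀ k : Fin m, φ ((X - C (Z 0)) * X ^ (k : ℕ)) = 0 := by
      intro k
      rw [← hM]
      refine Matrix.det_zero_of_column_eq (i := 0) (j := k.succ) (Fin.succ_ne_zero k).symm ?_
      intro i
      simp [M, ℓ']
    set q : Polynomial A := ∏ i ∈ Finset.range l, (X - C (Z (i + 1))) with hq
    have hq_deg : q.natDegree ≤ l := by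
      rw [hq, Polynomial.natDegree_prod_of_monic _ _ fun i _ => Polynomial.monic_X_sub_C _]
      simp
    have hq_eval : q.eval (Z 0) = ∏ i ∈ Finset.range l, (Z 0 - Z (i + 1)) := by
      simp [hq, Polynomial.eval_prod]
    obtain ⟨g, hg⟩ := exists_sub_eval_eq q (Z 0) m l hq_deg hl'
    have hφq : φ q = (∏ i ∈ Finset.range l, (Z 0 - Z (i + 1))) * φ 1 := by
      rw [hg, map_add, map_sum]
      simp only [map_smul, hφ, smul_zero, Finset.sum_const_zero, add_zero]
      rw [← hq_eval, ← Polynomial.algebraMap_eq, Algebra.algebraMap_eq_smul_one, map_smul,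
        smul_eq_mul]
    have h1 : (Matrix.of fun i j : Fin (m + 1) => ℓ i (X ^ (j : ℕ))).det = φ 1 := by
      -- The family 1, X - Z_0, (X - Z_0) X, ... is monic with degrees 0, 1, 2, ..., so it computes
      -- the same determinant as the powers of X.
      let P : ℕ → Polynomial A := fun j =>
        Nat.casesOn j 1 fun k => (X - C (Z 0)) * X ^ k
      rw [← hM, ← det_apply_monic ℓ P]
      · congr 1
        ext i j
        refine Fin.cases ?_ (fun j => ?_) j <;> simp [M, P, ℓ']
      · rintro (_ | k)
        · simp [P]
        · simp only [P]
          rw [(Polynomial.monic_X_sub_C _).natDegree_mul (Polynomial.monic_X_pow k)]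
          simp [add_comm]
      · rintro (_ | k)
        · simp [P]
        · exact (Polynomial.monic_X_sub_C _).mul (Polynomial.monic_X_pow k)
    rw [diffProd_succ, h1, mul_right_comm, ← hφq, Matrix.det_succ_column_zero]
    simp only [φ, LinearMap.sum_apply, LinearMap.smul_apply, smul_eq_mul, Finset.sum_mul]
    refine Finset.sum_congr rfl fun i _ => ?_
    have hsub : (Matrix.of fun i j : Fin (m + 1) =>
        ℓ i (lagrangeFamily Z B (l + 1) j)).submatrix i.succAbove Fin.succ =
        Matrix.of fun (i' j : Fin m) =>
          ℓ' (i.succAbove i') (lagrangeFamily (fun i => Z (i + 1)) B l j) := by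
      ext i' j
      simp [ℓ', lagrangeFamily_succ]
    rw [hsub, ← ih hl' (fun i => Z (i + 1)) fun i' => ℓ' (i.succAbove i')]
    simp only [Matrix.of_apply, Fin.val_zero, lagrangeFamily_zero, ← hq]
    ring

end Determinants

/-! ### Two-sided coefficient sequences and the Jacobi–Trudi functionals. -/

section Sequences

open Polynomial (X C)

variable {A B : Type*} [CommRing A] [CommRing B]

/-- The coefficients of a power series, indexed by all integers. -/
def zcoeff (G : PowerSeries A) (n : ℤ) : A :=
  if 0 ≤ n then PowerSeries.coeff n.toNat G else 0

theorem zcoeff_natCast (G : PowerSeries A) (n : ℕ) : zcoeff G n = PowerSeries.coeff n G := by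
  simp [zcoeff]

theorem zcoeff_of_neg (G : PowerSeries A) {n : ℤ} (h : n < 0) : zcoeff G n = 0 :=
  if_neg (not_le.2 h)

theorem zcoeff_add (F G : PowerSeries A) (n : ℤ) : zcoeff (F + G) n = zcoeff F n + zcoeff G n := by
  unfold zcoeff; split_ifs <;> simp

theorem zcoeff_sub (F G : PowerSeries A) (n : ℤ) : zcoeff (F - G) n = zcoeff F n - zcoeff G n := by
  unfold zcoeff; split_ifs <;> simp

theorem zcoeff_C_mul (a : A) (G : PowerSeries A) (n : ℤ) :
    zcoeff (PowerSeries.C a * G) n = a * zcoeff G n := by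
  unfold zcoeff; split_ifs <;> simp

theorem zcoeff_X_mul (G : PowerSeries A) (n : ℤ) :
    zcoeff (PowerSeries.X * G) n = zcoeff G (n - 1) := by
  rcases lt_trichotomy n 0 with h | rfl | h
  · rw [zcoeff_of_neg _ h, zcoeff_of_neg _ (by omega)]
  · rw [zcoeff_of_neg G (n := 0 - 1) (by norm_num)]
    simp [zcoeff]
  · obtain ⟨k, rfl⟩ : ∃ k : ℕ, n = (k + 1 : ℕ) := ⟨(n - 1).toNat, by omega⟩
    rw [zcoeff_natCast, PowerSeries.coeff_succ_X_mul, Nat.cast_succ, add_sub_cancel_right,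
      zcoeff_natCast]

theorem zcoeff_map (f : A →+* B) (G : PowerSeries A) (n : ℤ) :
    zcoeff (PowerSeries.map f G) n = f (zcoeff G n) := by
  unfold zcoeff; split_ifs <;> simp

theorem zcoeff_one (n : ℤ) : zcoeff (1 : PowerSeries A) n = if n = 0 then 1 else 0 := by
  unfold zcoeff
  split_ifs with h1 h2 h2
  · simp [h2]
  · rw [PowerSeries.coeff_one, if_neg (by omega)]
  · omega
  · rfl

/-- The factor `1 - u z`. -/
def linFactor (u : A) : PowerSeries A := 1 - PowerSeries.C u * PowerSeries.X

theorem map_linFactor (f : A →+* B) (u : A) :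
    PowerSeries.map f (linFactor u) = linFactor (f u) := by
  simp [linFactor]

theorem zcoeff_linFactor_mul (u : A) (G : PowerSeries A) (n : ℤ) :
    zcoeff (linFactor u * G) n = zcoeff G n - u * zcoeff G (n - 1) := by
  rw [linFactor, sub_mul, one_mul, zcoeff_sub, mul_assoc, zcoeff_C_mul, zcoeff_X_mul]

/-- The geometric series `1 / (1 - u z)`. -/
def geomFactor (u : A) : PowerSeries A :=
  PowerSeries.invOfUnit (1 - PowerSeries.C u * PowerSeries.X) 1

theorem linFactor_mul_geomFactor (u : A) : linFactor u * geomFactor u = 1 :=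
  PowerSeries.mul_invOfUnit _ _ (by simp [linFactor])

theorem map_geomFactor (f : A →+* B) (u : A) :
    PowerSeries.map f (geomFactor u) = geomFactor (f u) := by
  have h := congrArg (PowerSeries.map f) (linFactor_mul_geomFactor u)
  rw [map_mul, map_linFactor, map_one] at h
  exact eq_comm.1 (left_inv_eq_right_inv (by rw [mul_comm]; exact linFactor_mul_geomFactor (f u)) h)

/-- The operator `s ↦ (q ↦ s (q + 1))` on two-sided sequences. -/
def shift (A : Type*) [CommRing A] : Module.End A (ℤ → A) :=
  LinearMap.funLeft A A fun q => q + 1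

/-- The operator `s ↦ (q ↦ s (q + 1) + s (q - 1))` on two-sided sequences. -/
def symShift (A : Type*) [CommRing A] : Module.End A (ℤ → A) :=
  shift A + LinearMap.funLeft A A fun q => q - 1

theorem symShift_apply (s : ℤ → A) (q : ℤ) : symShift A s q = s (q + 1) + s (q - 1) := rfl

theorem commute_symShift_shift : Commute (symShift A) (shift A) := by
  refine LinearMap.ext fun s => funext fun q => ?_
  simp only [Module.End.mul_apply, shift, LinearMap.funLeft_apply, symShift_apply]
  rw [add_sub_right_comm]

theorem aeval_symShift_shift (P : Polynomial A) (s : ℤ → A) :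
    Polynomial.aeval (symShift A) P (shift A s) =
      shift A (Polynomial.aeval (symShift A) P s) := by
  have h : Commute (Polynomial.aeval (symShift A) P) (shift A) := by
    induction P using Polynomial.induction_on' with
    | add p q hp hq => rw [map_add]; exact hp.add_left hq
    | monomial n a =>
      rw [Polynomial.aeval_monomial]
      exact (Algebra.commute_algebraMap_left _ _).mul_left (commute_symShift_shift.pow_left n)
  exact LinearMap.congr_fun h.eq s

/-- The monic polynomials `B_0 = 1`, `B_1 = X - 1`, `B_{j+2} = X B_{j+1} - B_j`, so that
`(1 + z) B_j (z + z⁻¹) = z ^ (j + 1) + z ^ (-j)`. -/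
def oddPoly (A : Type*) [CommRing A] : ℕ → Polynomial A
  | 0 => 1
  | 1 => X - 1
  | j + 2 => X * oddPoly A (j + 1) - oddPoly A j

theorem oddPoly_degree [Nontrivial A] (j : ℕ) :
    (oddPoly A j).Monic ∧ (oddPoly A j).natDegree = j := by
  induction j using Nat.strong_induction_on with
  | _ j ih =>
    match j, ih with
    | 0, _ => simp [oddPoly]
    | 1, _ =>
      have : oddPoly A 1 = X - C 1 := by simp [oddPoly]
      rw [this]
      exact ⟨Polynomial.monic_X_sub_C _, Polynomial.natDegree_X_sub_C _⟩
    | j + 2, ih =>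
      obtain ⟨h1, h2⟩ := ih (j + 1) (by omega)
      obtain ⟨h3, h4⟩ := ih j (by omega)
      have hm : (X * oddPoly A (j + 1)).Monic := Polynomial.monic_X.mul h1
      have hd : (X * oddPoly A (j + 1)).natDegree = j + 2 := by
        rw [Polynomial.monic_X.natDegree_mul h1, h2, Polynomial.natDegree_X]; ring
      have hlt : (oddPoly A j).degree < (X * oddPoly A (j + 1)).degree := by
        rw [Polynomial.degree_eq_natDegree hm.ne_zero, Polynomial.degree_eq_natDegree h3.ne_zero,
          hd, h4]
        exact_mod_cast (by omega : j < j + 2)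
      refine ⟨hm.sub_of_left hlt, ?_⟩
      rw [oddPoly, Polynomial.natDegree_sub_eq_left_of_natDegree_lt (by omega), hd]

theorem oddPoly_eval (z z' : A) (h : z * z' = 1) (j : ℕ) :
    (1 + z) * (oddPoly A j).eval (z + z') = z' ^ j + z ^ (j + 1) := by
  induction j using Nat.strong_induction_on with
  | _ j ih =>
    match j, ih with
    | 0, _ => simp [oddPoly]
    | 1, _ =>
      simp only [oddPoly, Polynomial.eval_sub, Polynomial.eval_X, Polynomial.eval_one]
      linear_combination h
    | j + 2, ih =>
      have h1 := ih (j + 1) (by omega)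
      have h2 := ih j (by omega)
      simp only [oddPoly, Polynomial.eval_sub, Polynomial.eval_mul, Polynomial.eval_X]
      linear_combination (z + z') * h1 - h2 + (z' ^ j + z ^ (j + 1)) * h

/-- The functional `P ↦ P (z + z⁻¹) (1 + z) G (z) [z ^ e]` on polynomials. -/
def jtFun (G : PowerSeries A) (e : ℤ) : Polynomial A →ₗ[A] A :=
  LinearMap.proj e ∘ₗ
    LinearMap.applyₗ (fun q => zcoeff G q + zcoeff G (q - 1) : ℤ → A) ∘ₗ
      (Polynomial.aeval (symShift A)).toLinearMap

theorem jtFun_apply (G : PowerSeries A) (e : ℤ) (P : Polynomial A) :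
    jtFun G e P =
      Polynomial.aeval (symShift A) P (fun q => zcoeff G q + zcoeff G (q - 1)) e := rfl

theorem jtFun_one (G : PowerSeries A) (e : ℤ) : jtFun G e 1 = zcoeff G e + zcoeff G (e - 1) := by
  simp [jtFun_apply]

/-- The operator `symShift` is multiplication by z + z⁻¹ on coefficient sequences, so (1 + z) B_j(z
+ z⁻¹) = z^{j+1} + z^{-j} yields the two terms. -/
theorem jtFun_oddPoly (G : PowerSeries A) (e : ℤ) (j : ℕ) :
    jtFun G e (oddPoly A j) = zcoeff G (e + j) + zcoeff G (e - 1 - j) := by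
  have key : ∀ q, Polynomial.aeval (symShift A) (oddPoly A j)
      (fun q => zcoeff G q + zcoeff G (q - 1)) q = zcoeff G (q + j) + zcoeff G (q - 1 - j) := by
    induction j using Nat.strong_induction_on with
    | _ j ih =>
      match j, ih with
      | 0, _ => simp [oddPoly]
      | 1, _ =>
        intro q
        simp only [oddPoly, map_sub, Polynomial.aeval_X, map_one, LinearMap.sub_apply,
          Pi.sub_apply, symShift_apply, Module.End.one_apply, Nat.cast_one, add_sub_cancel_right]
        abel
      | j + 2, ih =>
        intro q
        simp only [oddPoly, map_sub, map_mul, Polynomial.aeval_X, LinearMap.sub_apply,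
          Pi.sub_apply, Module.End.mul_apply, symShift_apply, ih (j + 1) (by omega),
          ih j (by omega)]
        push_cast
        rw [show q + 1 + ((j : ℤ) + 1) = q + (j + 2) by ring,
          show q + 1 - 1 - ((j : ℤ) + 1) = q - 1 - j by ring,
          show q - 1 + ((j : ℤ) + 1) = q + j by ring,
          show q - 1 - 1 - ((j : ℤ) + 1) = q - 1 - (j + 2) by ring]
        ring
  exact key e

/-- This is z + z⁻¹ - u - u⁻¹ = z⁻¹ (1 - uz)(1 - u⁻¹z); the factor z⁻¹ accounts for e + 1. -/
theorem jtFun_X_sub_C_mul (G : PowerSeries A) (e : ℤ) {u u' : A} (h : u * u' = 1)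
    (P : Polynomial A) :
    jtFun G e ((X - C (u + u')) * P) = jtFun (linFactor u * linFactor u' * G) (e + 1) P := by
  rw [mul_comm, jtFun_apply, map_mul, Module.End.mul_apply, jtFun_apply]
  have : Polynomial.aeval (symShift A) (X - C (u + u'))
      (fun q => zcoeff G q + zcoeff G (q - 1)) =
      shift A (fun q => zcoeff (linFactor u * linFactor u' * G) q +
        zcoeff (linFactor u * linFactor u' * G) (q - 1)) := by
    funext q
    simp only [map_sub, Polynomial.aeval_X, Polynomial.aeval_C, LinearMap.sub_apply,
      Pi.sub_apply, symShift_apply, shift, LinearMap.funLeft_apply, mul_assoc,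
      zcoeff_linFactor_mul, Module.algebraMap_end_apply, Pi.smul_apply, smul_eq_mul,
      add_sub_cancel_right]
    linear_combination (zcoeff G (q - 1) + zcoeff G (q - 1 - 1)) * (-h)
  rw [this, aeval_symShift_shift]
  rfl

theorem jtFun_prod_mul {ι : Type*} (G : PowerSeries A) (e : ℤ) (s : Finset ι) (u u' : ι → A)
    (h : ∀ i, u i * u' i = 1) (P : Polynomial A) :
    jtFun G e ((∏ i ∈ s, (X - C (u i + u' i))) * P) =
      jtFun ((∏ i ∈ s, linFactor (u i) * linFactor (u' i)) * G) (e + s.card) P := by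
  classical
  induction s using Finset.induction_on generalizing P with
  | empty => simp
  | insert a s ha ih =>
    rw [Finset.prod_insert ha, mul_assoc, mul_left_comm, ih, jtFun_X_sub_C_mul _ _ (h a),
      Finset.prod_insert ha, Finset.card_insert_of_notMem ha, ← mul_assoc,
      Nat.cast_succ, add_assoc]

end Sequences

/-! ### Exponential series characterized by their differential equation. -/

section ExponentialSeries

variable {A B : Type*} [CommRing A] [CommRing B]

/-- `G = exp (∑_{n ≥ 1} p_n z ^ n / n)`, expressed by its differential equation. -/
def IsExp (p : ℕ+ → A) (G : PowerSeries A) : Prop :=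
  PowerSeries.constantCoeff G = 1 ∧
    PowerSeries.derivative A G = PowerSeries.mk (fun n => p n.succPNat) * G

/-- The equation determines (n + 1) times each coefficient from the earlier ones, and n + 1 is
invertible in a ℚ-algebra. Images of Γ_- under ring homomorphisms are identified this way, by
comparing power sums only. -/
theorem IsExp.unique [Algebra ℚ A] {p : ℕ+ → A} {F G : PowerSeries A} (hF : IsExp p F)
    (hG : IsExp p G) : F = G := by
  ext n
  induction n using Nat.strong_induction_on with
  | _ n ih =>
    rcases n with _ | n
    · simpa using hF.1.trans hG.1.symm
    · have h1 := congrArg (PowerSeries.coeff n) hF.2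
      have h2 := congrArg (PowerSeries.coeff n) hG.2
      rw [PowerSeries.coeff_derivative, PowerSeries.coeff_mul] at h1 h2
      have h3 : PowerSeries.coeff (n + 1) F * ((n : A) + 1) =
          PowerSeries.coeff (n + 1) G * ((n : A) + 1) := by
        rw [h1, h2]
        refine Finset.sum_congr rfl fun x hx => ?_
        rw [ih x.2 (by have := Finset.HasAntidiagonal.mem_antidiagonal.1 hx; omega)]
      have hu : IsUnit ((n : A) + 1) := by
        have : ((n : A) + 1) = algebraMap ℚ A ((n : ℚ) + 1) := by simp
        rw [this]
        exact (IsUnit.mk0 _ (by positivity)).map _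
      exact hu.mul_right_cancel h3

theorem IsExp.one : IsExp (fun _ => (0 : A)) 1 := by
  refine ⟨by simp, ?_⟩
  have : PowerSeries.mk (fun _ => (0 : A)) = 0 := by ext; simp
  rw [this]
  simp

theorem IsExp.mul {p q : ℕ+ → A} {F G : PowerSeries A} (hF : IsExp p F) (hG : IsExp q G) :
    IsExp (fun n => p n + q n) (F * G) := by
  refine ⟨by rw [map_mul, hF.1, hG.1, mul_one], ?_⟩
  rw [Derivation.leibniz, hF.2, hG.2]
  have : PowerSeries.mk (fun n : ℕ => p n.succPNat + q n.succPNat) =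
    PowerSeries.mk (fun n => p n.succPNat) + PowerSeries.mk (fun n => q n.succPNat) := by
    ext; simp
  rw [this, smul_eq_mul, smul_eq_mul]
  ring

theorem IsExp.prod {ι : Type*} {p : ι → ℕ+ → A} {F : ι → PowerSeries A} (s : Finset ι)
    (h : ∀ i, IsExp (p i) (F i)) : IsExp (fun n => ∑ i ∈ s, p i n) (∏ i ∈ s, F i) := by
  classical
  induction s using Finset.induction_on with
  | empty => simpa using IsExp.one
  | insert a s ha ih =>
    simp only [Finset.prod_insert ha, Finset.sum_insert ha]
    exact (h a).mul ih

theorem IsExp.map {p : ℕ+ → A} {F : PowerSeries A} (hF : IsExp p F) (f : A →+* B) :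
    IsExp (fun n => f (p n)) (PowerSeries.map f F) := by
  refine ⟨by rw [← PowerSeries.coeff_zero_eq_constantCoeff_apply, PowerSeries.coeff_map,
    PowerSeries.coeff_zero_eq_constantCoeff_apply, hF.1, map_one], ?_⟩
  have h := congrArg (PowerSeries.map f) hF.2
  rw [map_mul] at h
  convert h using 1
  · ext n
    simp [PowerSeries.coeff_derivative]
  · congr 1

theorem mk_pow_succ (u : A) :
    PowerSeries.mk (fun n => u ^ (n.succPNat : ℕ)) = PowerSeries.C u * geomFactor u := by
  have h : PowerSeries.mk (fun n => u ^ (n.succPNat : ℕ)) * linFactor u = PowerSeries.C u := by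
    ext n
    rw [mul_comm]
    rcases n with _ | n
    · simp [linFactor]
    · rw [linFactor, sub_mul, one_mul, mul_assoc, map_sub, PowerSeries.coeff_C_mul,
        PowerSeries.coeff_succ_X_mul, PowerSeries.coeff_C]
      simp [pow_succ']
  rw [← h, mul_assoc, linFactor_mul_geomFactor, mul_one]

theorem IsExp.geomFactor (u : A) : IsExp (fun n => u ^ (n : ℕ)) (geomFactor u) := by
  have h := linFactor_mul_geomFactor u
  constructor
  · simp [OddOrth.geomFactor]
  · have h1 := congrArg (PowerSeries.derivative A) h
    rw [Derivation.leibniz] at h1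
    simp only [linFactor, map_sub, Derivation.leibniz, PowerSeries.derivative_X,
      PowerSeries.derivative_C, PowerSeries.derivative_one, smul_eq_mul] at h1
    rw [mk_pow_succ]
    have h2 := congrArg (fun t => OddOrth.geomFactor u * t) h1
    simp only [linFactor] at h h2
    linear_combination h2 - (PowerSeries.derivative A (OddOrth.geomFactor u)) * h

theorem IsExp.linFactor (u : A) : IsExp (fun n => -u ^ (n : ℕ)) (linFactor u) := by
  have h := linFactor_mul_geomFactor u
  constructor
  · simp [OddOrth.linFactor]
  · have : PowerSeries.mk (fun n : ℕ => -u ^ (n.succPNat : ℕ)) =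
        -(PowerSeries.C u * OddOrth.geomFactor u) := by
      rw [← mk_pow_succ]; ext; simp
    rw [this]
    simp only [OddOrth.linFactor, map_sub, Derivation.leibniz, PowerSeries.derivative_X,
      PowerSeries.derivative_C, PowerSeries.derivative_one, smul_eq_mul] at h ⊢
    linear_combination (PowerSeries.C u) * h

variable (R : Type*) [CommRing R] [Algebra ℚ R]

/-- `exp (∑_{n ≥ 1} (a_{-n} / n) z ^ n)`. -/
def creationExp : PowerSeries (Fock R) :=
  (PowerSeries.exp (Fock R)).subst (creationSeries R)

/-- `exp (- ∑_{n ≥ 1} (a_{-n} / n) z ^ n)`. -/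
def negCreationExp : PowerSeries (Fock R) :=
  (PowerSeries.exp (Fock R)).subst (-creationSeries R)

theorem derivative_creationSeries : PowerSeries.derivative (Fock R) (creationSeries R) =
    PowerSeries.mk fun n => MvPolynomial.X n.succPNat := by
  ext1 n
  rw [PowerSeries.coeff_derivative, creationSeries, PowerSeries.coeff_mk, PowerSeries.coeff_mk,
    dif_pos (Nat.succ_pos n), ← Nat.cast_succ, mul_comm, ← nsmul_eq_mul, ← Nat.cast_smul_eq_nsmul ℚ,
    smul_smul, mul_inv_cancel₀ (by positivity), one_smul]
  rfl

theorem isExp_subst {f : PowerSeries (Fock R)} (hf : PowerSeries.constantCoeff f = 0)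
    {p : ℕ+ → Fock R}
    (hp : PowerSeries.derivative (Fock R) f = PowerSeries.mk fun n => p n.succPNat) :
    IsExp p ((PowerSeries.exp (Fock R)).subst f) := by
  have hs : PowerSeries.HasSubst f := PowerSeries.HasSubst.of_constantCoeff_zero' hf
  refine ⟨?_, ?_⟩
  · refine (PowerSeries.constantCoeff_subst hs _).trans ?_
    rw [finsum_eq_single _ 0]
    · simp
    · intro n hn
      have hf' : MvPowerSeries.constantCoeff f = 0 := hf
      rw [map_pow, hf', zero_pow hn, smul_zero]
  · rw [PowerSeries.derivative_subst hs, PowerSeries.derivative_exp, hp, mul_comm]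

theorem isExp_creationExp : IsExp (fun n => (MvPolynomial.X n : Fock R)) (creationExp R) :=
  isExp_subst R (by simp [creationSeries]) (derivative_creationSeries R)

theorem isExp_negCreationExp :
    IsExp (fun n => -(MvPolynomial.X n : Fock R)) (negCreationExp R) :=
  isExp_subst R (by simp [creationSeries]) (by
    rw [map_neg, derivative_creationSeries]; ext1; simp)

end ExponentialSeries

/-! ### Kets as Jacobi–Trudi determinants. -/

section Kets

open LaurentPolynomial (T)

variable {B : Type*} [CommRing B]

/-- The coefficient of `z ^ n` in the product of a power series `G (z)` and a Laurent polynomial. -/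
def laurentPair (G : PowerSeries B) (n : ℤ) : B[T;T⁻¹] →ₗ[B] B where
  toFun f := f.coeff.sum fun i a => zcoeff G (n - i) * a
  map_add' f g := by
    rw [AddMonoidAlgebra.coeff_add]
    exact Finsupp.sum_add_index' (by simp) (by intros; ring)
  map_smul' b f := by
    rw [AddMonoidAlgebra.coeff_smul, Finsupp.sum_smul_index (by simp), RingHom.id_apply,
      smul_eq_mul, Finsupp.mul_sum]
    exact Finsupp.sum_congr fun i _ => by ring

theorem laurentPair_apply (G : PowerSeries B) (n : ℤ) (f : B[T;T⁻¹]) :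
    laurentPair G n f = f.coeff.sum fun i a => zcoeff G (n - i) * a := rfl

theorem laurentPair_T (G : PowerSeries B) (n i : ℤ) : laurentPair G n (T i) = zcoeff G (n - i) := by
  rw [laurentPair_apply, T, AddMonoidAlgebra.coeff_single, Finsupp.sum_single_index (by simp),
    mul_one]

theorem laurentPair_mul_C (G : PowerSeries B) (n : ℤ) (f : B[T;T⁻¹]) (b : B) :
    laurentPair G n (f * LaurentPolynomial.C b) = laurentPair G n f * b := by
  rw [mul_comm, ← LaurentPolynomial.smul_eq_C_mul, map_smul, smul_eq_mul, mul_comm]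

theorem T_mul_T_neg (i : ℤ) : (T i * T (-i) : B[T;T⁻¹]) = 1 := by
  rw [← LaurentPolynomial.T_add, add_neg_cancel, LaurentPolynomial.T_zero]

/-- Adding a row of the form `z ^ (j + 1) + z ^ (-j)` to a determinant of Jacobi–Trudi type. -/
theorem det_cons_row {A : Type*} [CommRing A] {z z' : A} (h : z * z' = 1) (G : PowerSeries A)
    {m : ℕ} (e : Fin m → ℤ) :
    (Matrix.of fun i j : Fin (m + 1) => Fin.cons (α := fun _ => A) (z' ^ (j : ℕ) + z ^ (j + 1 : ℕ))
        (fun i : Fin m => jtFun G (e i - 1) (oddPoly A j)) i).det =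
      (1 + z) * (Matrix.of fun i j : Fin m =>
        jtFun (linFactor z * linFactor z' * G) (e i) (oddPoly A j)).det := by
  nontriviality A
  -- The added row is (1 + z) times evaluation at z + z'. In the monic basis 1, (X - z - z') B_k
  -- this row vanishes beyond its first entry, so the determinant collapses to one minor.
  let ℓ : Fin (m + 1) → Polynomial A →ₗ[A] A :=
    Fin.cons ((1 + z) • Polynomial.leval (z + z')) fun i => jtFun G (e i - 1)
  let P : ℕ → Polynomial A := fun j =>
    Nat.casesOn j 1 fun k => (Polynomial.X - Polynomial.C (z + z')) * oddPoly A k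
  have h1 : (Matrix.of fun i j : Fin (m + 1) =>
      Fin.cons (α := fun _ => A) (z' ^ (j : ℕ) + z ^ (j + 1 : ℕ))
        (fun i : Fin m => jtFun G (e i - 1) (oddPoly A j)) i) =
      Matrix.of fun i j : Fin (m + 1) => ℓ i (oddPoly A j) := by
    ext i j
    refine Fin.cases ?_ (fun i => ?_) i
    · simp [ℓ, oddPoly_eval z z' h]
    · simp [ℓ]
  rw [h1, det_apply_monic ℓ _ (fun j => (oddPoly_degree j).2) fun j => (oddPoly_degree j).1,
    ← det_apply_monic ℓ P, Matrix.det_succ_row_zero, Fin.sum_univ_succ]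
  · have h2 : (Matrix.of fun i j : Fin (m + 1) => ℓ i (P j)).submatrix Fin.succ
        (Fin.succAbove 0) = Matrix.of fun i j : Fin m =>
          jtFun (linFactor z * linFactor z' * G) (e i) (oddPoly A j) := by
      ext i j
      have := jtFun_X_sub_C_mul G (e i - 1) h (oddPoly A j)
      rw [sub_add_cancel] at this
      simpa [ℓ, P] using this
    rw [h2, Finset.sum_eq_zero]
    · simp [ℓ, P]
    · intro j _
      simp [ℓ, P]
  · rintro (_ | k)
    · simp [P]
    · simp only [P]
      rw [(Polynomial.monic_X_sub_C _).natDegree_mul (oddPoly_degree k).1,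
        (oddPoly_degree k).2, Polynomial.natDegree_X_sub_C, add_comm]
  · rintro (_ | k)
    · simp [P]
    · exact (Polynomial.monic_X_sub_C _).mul (oddPoly_degree k).1

theorem map_jtFun_oddPoly {A A' : Type*} [CommRing A] [CommRing A'] (f : A →+* A')
    (G : PowerSeries A) (e : ℤ) (j : ℕ) :
    f (jtFun G e (oddPoly A j)) = jtFun (PowerSeries.map f G) e (oddPoly A' j) := by
  simp only [jtFun_oddPoly, zcoeff_map, map_add]

theorem map_det_jtFun {A A' : Type*} [CommRing A] [CommRing A'] (f : A →+* A')
    (G : PowerSeries A) {m : ℕ} (e : Fin m → ℤ) :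
    f (Matrix.of fun i j : Fin m => jtFun G (e i) (oddPoly A j)).det =
      (Matrix.of fun i j : Fin m => jtFun (PowerSeries.map f G) (e i) (oddPoly A' j)).det := by
  rw [RingHom.map_det]
  congr 1
  ext i j
  exact map_jtFun_oddPoly f G (e i) j

variable {R : Type*} [CommRing R]

theorem expAnnihilation_X {B : Type*} [CommRing B] [Algebra R B] [Algebra (Fock R) B]
    (c : ℕ+ → B) (n : ℕ+) : expAnnihilation c (MvPolynomial.X n : Fock R) =
      algebraMap (Fock R) B (MvPolynomial.X n) + c n :=
  MvPolynomial.aeval_X _ n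

variable [Algebra ℚ R]

theorem vertexU_eq (n : ℤ) (v : Fock R) :
    vertexU (-n) v = laurentPair (creationExp R) n
      ((1 + T 1) * expAnnihilation (fun k => -zPM R k) v) := by
  rw [vertexU, laurentPair_apply, neg_neg]
  rfl

theorem vertexUStar_eq (n : ℤ) (v : Fock R) :
    vertexUStar n v = laurentPair (negCreationExp R) n
      ((1 - T 1) * expAnnihilation (fun k => zPM R k) v) := rfl

/-- Translating a_{-n} by -(z^n + z^{-n}) adds minus the power sums of z and z⁻¹, i.e. multiplies
Γ_-(t) by (1 - zt)(1 - t/z). -/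
theorem map_expAnnihilation_neg_creationExp :
    PowerSeries.map (expAnnihilation fun k => -zPM R k).toRingHom (creationExp R) =
      linFactor (T 1) * linFactor (T (-1)) *
        PowerSeries.map LaurentPolynomial.C (creationExp R) := by
  have h1 := (isExp_creationExp R).map (expAnnihilation fun k => -zPM R k).toRingHom
  have h2 := ((IsExp.linFactor (T 1 : (Fock R)[T;T⁻¹])).mul (IsExp.linFactor (T (-1)))).mul
    ((isExp_creationExp R).map LaurentPolynomial.C)
  refine IsExp.unique (p := _) h1 ?_
  convert h2 using 2 with n
  refine (expAnnihilation_X _ n).trans ?_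
  rw [LaurentPolynomial.T_pow, LaurentPolynomial.T_pow, zPM, ← LaurentPolynomial.C_eq_algebraMap]
  simp only [mul_one, mul_neg]
  ring

/-- Induction on the number of operators: `det_cons_row`, read from right to left, turns the
translated determinant times 1 + z into one with the extra row z^{-j} + z^{j+1}. The pairing with
Γ_-(z) replaces z^i by the coefficient of index n - i, which makes this the Jacobi–Trudi row. -/
theorem foldr_vertexU {l : ℕ} (α : Fin l → ℤ) :
    (List.ofFn α).foldr (fun m v => vertexU (-m) v) (1 : Fock R) =
      (Matrix.of fun i j : Fin l =>
        jtFun (creationExp R) (α i - (i : ℤ)) (oddPoly (Fock R) j)).det := by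
  induction l with
  | zero => simp
  | succ l ih =>
    rw [List.ofFn_succ, List.foldr_cons, ih fun i => α i.succ, vertexU_eq]
    have h1 : expAnnihilation (fun k => -zPM R k) (Matrix.of fun i j : Fin l =>
        jtFun (creationExp R) (α i.succ - (i : ℤ)) (oddPoly (Fock R) j)).det =
        (Matrix.of fun i j : Fin l => jtFun (linFactor (T 1) * linFactor (T (-1)) *
          PowerSeries.map LaurentPolynomial.C (creationExp R)) (α i.succ - (i : ℤ))
            (oddPoly (Fock R)[T;T⁻¹] j)).det := by
      rw [← map_expAnnihilation_neg_creationExp]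
      exact map_det_jtFun (expAnnihilation fun k => -zPM R k).toRingHom (creationExp R) _
    rw [h1, ← det_cons_row (T_mul_T_neg 1), Matrix.det_succ_row_zero, map_sum,
      Matrix.det_succ_row_zero]
    refine Finset.sum_congr rfl fun j _ => ?_
    have h2 : (Matrix.of fun i j : Fin (l + 1) => Fin.cons (α := fun _ => (Fock R)[T;T⁻¹])
        (T (-1) ^ (j : ℕ) + T 1 ^ (j + 1 : ℕ)) (fun i : Fin l =>
          jtFun (PowerSeries.map LaurentPolynomial.C (creationExp R))
            (α i.succ - (i : ℤ) - 1) (oddPoly (Fock R)[T;T⁻¹] j)) i).submatrix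
          Fin.succ j.succAbove =
        (LaurentPolynomial.C : Fock R →+* (Fock R)[T;T⁻¹]).mapMatrix
          ((Matrix.of fun i j : Fin (l + 1) => jtFun (creationExp R) (α i - (i : ℤ))
            (oddPoly (Fock R) j)).submatrix Fin.succ j.succAbove) := by
      ext1 i k
      simp only [Matrix.submatrix_apply, Matrix.of_apply, Fin.cons_succ, RingHom.mapMatrix_apply,
        Matrix.map_apply, map_jtFun_oddPoly, Fin.val_succ, Nat.cast_succ, sub_sub]
    rw [h2, ← RingHom.map_det, laurentPair_mul_C]
    congr 1
    have h3 : ((-1) ^ (j : ℕ) : (Fock R)[T;T⁻¹]) = LaurentPolynomial.C ((-1) ^ (j : ℕ)) := by simp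
    rw [h3, mul_comm, laurentPair_mul_C, mul_comm]
    congr 1
    simp only [Matrix.of_apply, Fin.cons_zero, LaurentPolynomial.T_pow, map_add, laurentPair_T,
      jtFun_oddPoly]
    congr 2
    · rw [Fin.val_zero]; push_cast; ring
    · rw [Fin.val_zero]; push_cast; ring

/-- In `ket` and `bra` the list of parts is cast to integers by a monadic bind; this brings it to
the form used in the two fold formulas. -/
theorem bind_ofFn_coe {l : ℕ} (α : Fin l → ℕ) :
    (do let a ← List.ofFn α; pure (a : ℤ)) = List.ofFn fun i => (α i : ℤ) := by
  simp only [List.bind_eq_flatMap, List.pure_def, ← List.map_eq_flatMap, List.map_ofFn]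
  rfl

theorem ket_eq_det {l : ℕ} (lam : GenPartition l) :
    ket (R := R) lam = (Matrix.of fun i j : Fin l =>
      jtFun (creationExp R) ((lam.1 i : ℤ) - (i : ℤ)) (oddPoly (Fock R) j)).det := by
  rw [ket, bind_ofFn_coe, foldr_vertexU]

end Kets

/-! ### Bras as coefficients of the Weyl denominator times an evaluation. -/

section MultivariateLaurent

open LaurentPolynomial (T)

/-- Laurent polynomials in `l` variables. -/
abbrev MvLaurent (R : Type*) [CommRing R] (l : ℕ) : Type _ := AddMonoidAlgebra R (Fin l → ℤ)

variable {R : Type*} [CommRing R] {l : ℕ}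

/-- The power `z_k ^ n` of the variable `z_k`, read as `1` when `k ≥ l`. -/
def mvT (R : Type*) [CommRing R] (l k : ℕ) (n : ℤ) : MvLaurent R l :=
  AddMonoidAlgebra.single (fun i => if (i : ℕ) = k then n else 0) 1

theorem mvT_zero (k : ℕ) : mvT R l k 0 = 1 := by
  simp only [mvT, ite_self]; rfl

theorem mvT_mul (k : ℕ) (m n : ℤ) : mvT R l k m * mvT R l k n = mvT R l k (m + n) := by
  rw [mvT, mvT, AddMonoidAlgebra.single_mul_single, mul_one, mvT]
  congr 1
  funext i
  rw [Pi.add_apply]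
  split_ifs <;> simp

theorem mvT_mul_neg (k : ℕ) (n : ℤ) : mvT R l k n * mvT R l k (-n) = 1 := by
  rw [mvT_mul, add_neg_cancel, mvT_zero]

theorem mvT_pow (k : ℕ) (n : ℤ) (m : ℕ) : mvT R l k n ^ m = mvT R l k (m * n) := by
  induction m with
  | zero => simp [mvT_zero]
  | succ m ih =>
    rw [pow_succ, ih, mvT_mul]
    congr 1
    push_cast
    ring

theorem coeff_single_one_mul' (a e : Fin l → ℤ) (g : MvLaurent R l) :
    (AddMonoidAlgebra.single a (1 : R) * g).coeff e = g.coeff (e - a) := by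
  rw [AddMonoidAlgebra.coeff_single_mul_eq_mul_coeff (e - a), one_mul]
  intro m _
  constructor
  · rintro rfl; simp
  · rintro rfl; simp

theorem coeff_mvT_mul (k : ℕ) (n : ℤ) (g : MvLaurent R l) (e : Fin l → ℤ) :
    (mvT R l k n * g).coeff e = g.coeff fun i => if (i : ℕ) = k then e i - n else e i := by
  rw [mvT, coeff_single_one_mul']
  congr 1
  funext i
  rw [Pi.sub_apply]
  split_ifs <;> simp

/-- The element `z_k + z_k⁻¹`. -/
def mvSym (R : Type*) [CommRing R] (l k : ℕ) : MvLaurent R l := mvT R l k 1 + mvT R l k (-1)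

/-- Inserting a zero exponent in front, as a homomorphism. -/
def consZero (l : ℕ) : (Fin l → ℤ) →+ (Fin (l + 1) → ℤ) where
  toFun e := Fin.cons (α := fun _ => ℤ) 0 e
  map_zero' := by funext i; refine Fin.cases ?_ (fun i => ?_) i <;> simp
  map_add' a b := by funext i; refine Fin.cases ?_ (fun i => ?_) i <;> simp

/-- The embedding `z_k ↦ z_{k+1}` of Laurent polynomials. -/
def mvEmbed (R : Type*) [CommRing R] (l : ℕ) : MvLaurent R l →+* MvLaurent R (l + 1) :=
  AddMonoidAlgebra.mapDomainRingHom R (consZero l)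

theorem mvEmbed_single (e : Fin l → ℤ) (r : R) :
    mvEmbed R l (AddMonoidAlgebra.single e r) = AddMonoidAlgebra.single (consZero l e) r :=
  AddMonoidAlgebra.mapDomain_single

theorem mvEmbed_mvT (k : ℕ) (n : ℤ) : mvEmbed R l (mvT R l k n) = mvT R (l + 1) (k + 1) n := by
  rw [mvT, mvEmbed_single, mvT]
  congr 1
  funext i
  refine Fin.cases ?_ (fun i => ?_) i
  · simp [consZero]
  · simp [consZero]

theorem coeff_mvEmbed (b : MvLaurent R l) (n : ℤ) (e : Fin l → ℤ) :
    (mvEmbed R l b).coeff (Fin.cons (α := fun _ => ℤ) n e) = if n = 0 then b.coeff e else 0 := by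
  have hc : (mvEmbed R l b).coeff = Finsupp.mapDomain (consZero l) b.coeff :=
    AddMonoidAlgebra.coeff_mapDomain _ _
  have hinj : Function.Injective (consZero l) := fun a b h =>
    funext fun i => by simpa [consZero] using congrFun h i.succ
  rw [hc]
  split_ifs with h
  · subst h
    exact Finsupp.mapDomain_apply hinj _ _
  · refine Finsupp.mapDomain_of_notMem_range _ _ ?_
    rintro ⟨a, ha⟩
    exact h (by simpa [consZero] using (congrFun ha 0).symm)

/-- The power series `F` and the Laurent polynomial `F'` have the same expansion, the variable of
`F` being the first variable of `F'`. -/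
def SameExpansion (F : PowerSeries (MvLaurent R l)) (F' : MvLaurent R (l + 1)) : Prop :=
  ∀ (b : MvLaurent R l) (n : ℤ) (e : Fin l → ℤ),
    (mvEmbed R l b * F').coeff (Fin.cons (α := fun _ => ℤ) n e) = (b * zcoeff F n).coeff e

theorem sameExpansion_one : SameExpansion (1 : PowerSeries (MvLaurent R l)) 1 := by
  intro b n e
  rw [mul_one, coeff_mvEmbed, zcoeff_one]
  split_ifs <;> simp

theorem coeff_mvT_zero_mul_cons (g : MvLaurent R (l + 1)) (i n : ℤ) (e : Fin l → ℤ) :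
    (mvT R (l + 1) 0 i * g).coeff (Fin.cons (α := fun _ => ℤ) n e) =
      g.coeff (Fin.cons (α := fun _ => ℤ) (n - i) e) := by
  rw [coeff_mvT_mul]
  congr 1
  funext k
  refine Fin.cases ?_ (fun k => ?_) k <;> simp

theorem SameExpansion.linFactor_mul {F : PowerSeries (MvLaurent R l)} {F' : MvLaurent R (l + 1)}
    (h : SameExpansion F F') (u : MvLaurent R l) :
    SameExpansion (linFactor u * F) ((1 - mvT R (l + 1) 0 1 * mvEmbed R l u) * F') := by
  intro b n e
  have : mvEmbed R l b * ((1 - mvT R (l + 1) 0 1 * mvEmbed R l u) * F') =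
      mvEmbed R l b * F' - mvT R (l + 1) 0 1 * (mvEmbed R l (b * u) * F') := by
    rw [map_mul]; ring
  rw [this, zcoeff_linFactor_mul, mul_sub, AddMonoidAlgebra.coeff_sub,
    AddMonoidAlgebra.coeff_sub, Finsupp.sub_apply, Finsupp.sub_apply, coeff_mvT_zero_mul_cons,
    h, h, mul_assoc]

/-- The Laurent polynomial `∏_k (1 - z_k) z_k ^ (l - 1 - k) ∏_{i < j} (z_i + z_i⁻¹ - z_j - z_j⁻¹)`,
the Weyl denominator of type `B` up to a monomial. -/
def weylDen (R : Type*) [CommRing R] (l : ℕ) : MvLaurent R l :=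
  (∏ k ∈ Finset.range l, (1 - mvT R l k 1) * mvT R l k (l - 1 - k)) * diffProd (mvSym R l) l

theorem map_diffProd {A A' : Type*} [CommRing A] [CommRing A'] (f : A →+* A') (Z : ℕ → A) (n : ℕ) :
    f (diffProd Z n) = diffProd (fun i => f (Z i)) n := by
  simp [diffProd]

/-- Based on (1 - z_0 z_i)(1 - z_0 z_i⁻¹) = z_0 (z_0 + z_0⁻¹ - z_i - z_i⁻¹); the l factors z_0 form
the monomial z_0^l of `weylDen`. -/
theorem weylDen_succ (R : Type*) [CommRing R] (l : ℕ) : weylDen R (l + 1) =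
    (1 - mvT R (l + 1) 0 1) * (∏ i ∈ Finset.range l,
      ((1 - mvT R (l + 1) 0 1 * mvEmbed R l (mvT R l i 1)) *
        (1 - mvT R (l + 1) 0 1 * mvEmbed R l (mvT R l i (-1))))) * mvEmbed R l (weylDen R l) := by
  have hZ : (fun i => mvEmbed R l (mvSym R l i)) = fun i => mvSym R (l + 1) (i + 1) := by
    funext i
    simp [mvSym, mvEmbed_mvT]
  have h1 : ∏ i ∈ Finset.range l, ((1 - mvT R (l + 1) 0 1 * mvEmbed R l (mvT R l i 1)) *
        (1 - mvT R (l + 1) 0 1 * mvEmbed R l (mvT R l i (-1)))) =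
      mvT R (l + 1) 0 l * ∏ i ∈ Finset.range l, (mvSym R (l + 1) 0 - mvSym R (l + 1) (i + 1)) := by
    have h2 : mvT R (l + 1) 0 l = ∏ i ∈ Finset.range l, mvT R (l + 1) 0 1 := by
      simp [mvT_pow]
    rw [h2, ← Finset.prod_mul_distrib]
    refine Finset.prod_congr rfl fun i _ => ?_
    have e1 := mvT_mul_neg (R := R) (l := l + 1) 0 1
    have e2 := mvT_mul_neg (R := R) (l := l + 1) (i + 1) 1
    rw [mvEmbed_mvT, mvEmbed_mvT, mvSym, mvSym]
    linear_combination (mvT R (l + 1) 0 1) ^ 2 * e2 - e1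
  rw [h1, weylDen, weylDen, diffProd_succ, Finset.prod_range_succ', map_mul, map_diffProd, hZ,
    map_prod]
  have h3 : ∀ k : ℕ, (1 - mvT R (l + 1) (k + 1) 1) *
      mvT R (l + 1) (k + 1) (((l + 1 : ℕ) : ℤ) - 1 - ((k + 1 : ℕ) : ℤ)) =
      mvEmbed R l ((1 - mvT R l k 1) * mvT R l k (l - 1 - k)) := by
    intro k
    rw [map_mul, map_sub, map_one, mvEmbed_mvT, mvEmbed_mvT]
    congr 2
    push_cast
    ring
  simp only [h3]
  have h4 : ((l + 1 : ℕ) : ℤ) - 1 - ((0 : ℕ) : ℤ) = l := by push_cast; ring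
  rw [h4]
  ring

/-- The evaluation `a_{-n} ↦ ∑_k (z_k ^ n + z_k ^ (-n))`. -/
def evSym (R : Type*) [CommRing R] (l : ℕ) : Fock R →ₐ[R] MvLaurent R l :=
  MvPolynomial.aeval fun n =>
    ∑ k ∈ Finset.range l, (mvT R l k (n : ℕ) + mvT R l k (-(n : ℕ)))

theorem evSym_X (n : ℕ+) : evSym R l (MvPolynomial.X n) =
    ∑ k ∈ Finset.range l, (mvT R l k (n : ℕ) + mvT R l k (-(n : ℕ))) :=
  MvPolynomial.aeval_X _ n

theorem sameExpansion_prod (s : Finset ℕ) : SameExpansion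
    (∏ k ∈ s, (linFactor (mvT R l k 1) * linFactor (mvT R l k (-1))))
    (∏ i ∈ s, ((1 - mvT R (l + 1) 0 1 * mvEmbed R l (mvT R l i 1)) *
        (1 - mvT R (l + 1) 0 1 * mvEmbed R l (mvT R l i (-1))))) := by
  induction s using Finset.induction_on with
  | empty => exact sameExpansion_one
  | insert a s ha ih =>
    rw [Finset.prod_insert ha, Finset.prod_insert ha, mul_assoc, mul_assoc]
    exact (ih.linFactor_mul _).linFactor_mul _

/-- The homomorphism `(Fock R)[T;T⁻¹] → MvLaurent R (l + 1)` sending `T` to the first variable and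
evaluating the coefficients at the remaining ones. -/
def evFirst (R : Type*) [CommRing R] (l : ℕ) : (Fock R)[T;T⁻¹] →+* MvLaurent R (l + 1) :=
  AddMonoidAlgebra.liftNCRingHom ((mvEmbed R l).comp (evSym R l).toRingHom)
    { toFun := fun n => mvT R (l + 1) 0 n.toAdd
      map_one' := mvT_zero 0
      map_mul' := fun m n => (mvT_mul 0 m.toAdd n.toAdd).symm }
    fun _ _ => Commute.all _ _

theorem evFirst_C_mul_T (a : Fock R) (n : ℤ) : evFirst R l (LaurentPolynomial.C a * T n) =
    mvEmbed R l (evSym R l a) * mvT R (l + 1) 0 n := by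
  rw [← LaurentPolynomial.single_eq_C_mul_T]
  exact AddMonoidAlgebra.liftNCRingHom_single _ _ _ _ _

theorem evFirst_T (n : ℤ) : evFirst R l (T n) = mvT R (l + 1) 0 n := by
  have := evFirst_C_mul_T (R := R) (l := l) 1 n
  simpa using this

theorem evFirst_C (a : Fock R) : evFirst R l (LaurentPolynomial.C a) =
    mvEmbed R l (evSym R l a) := by
  have := evFirst_C_mul_T (R := R) (l := l) a 0
  simpa [mvT_zero] using this

/-- The translation in U^*(z_0) adds the contribution of the new variable z_0 to each power sum. -/
theorem evFirst_expAnnihilation (v : Fock R) :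
    evFirst R l (expAnnihilation (fun k => zPM R k) v) = evSym R (l + 1) v := by
  have h : (evFirst R l).comp (expAnnihilation fun k => zPM R k).toRingHom =
      (evSym R (l + 1)).toRingHom := by
    refine MvPolynomial.ringHom_ext (fun r => ?_) fun n => ?_
    · change evFirst R l (expAnnihilation (fun k => zPM R k) (MvPolynomial.C r)) =
        evSym R (l + 1) (MvPolynomial.C r)
      rw [← MvPolynomial.algebraMap_eq, AlgHom.commutes, AlgHom.commutes,
        IsScalarTower.algebraMap_apply R (Fock R) (Fock R)[T;T⁻¹],
        ← LaurentPolynomial.C_eq_algebraMap, evFirst_C, AlgHom.commutes]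
      refine (mvEmbed_single _ _).trans ?_
      rw [map_zero]
      rfl
    · change evFirst R l (expAnnihilation (fun k => zPM R k) (MvPolynomial.X n)) =
        evSym R (l + 1) (MvPolynomial.X n)
      rw [expAnnihilation_X, zPM, ← LaurentPolynomial.C_eq_algebraMap, map_add, map_add,
        evFirst_C, evFirst_T, evFirst_T, evSym_X, evSym_X, Finset.sum_range_succ', map_sum]
      simp [mvEmbed_mvT]
  exact RingHom.congr_fun h v

variable [Algebra ℚ R]

theorem map_evSym_negCreationExp :
    PowerSeries.map (evSym R l).toRingHom (negCreationExp R) =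
      ∏ k ∈ Finset.range l, (linFactor (mvT R l k 1) * linFactor (mvT R l k (-1))) := by
  have h1 := (isExp_negCreationExp R).map (evSym R l).toRingHom
  have h2 := IsExp.prod (Finset.range l) fun k =>
    (IsExp.linFactor (mvT R l k 1)).mul (IsExp.linFactor (mvT R l k (-1)))
  refine IsExp.unique (p := _) h1 ?_
  convert h2 using 2 with n
  refine (map_neg (evSym R l) _).trans ?_
  rw [evSym_X, ← Finset.sum_neg_distrib]
  refine Finset.sum_congr rfl fun k _ => ?_
  rw [mvT_pow, mvT_pow, mul_one, mul_neg, mul_one, neg_add]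

/-- The multiplication part of U^*(z_0) is hit by the later translations, which turn it into ∏_i (1
- z_0 z_i)(1 - z_0 z_i⁻¹). The multiplier b leaves room for the denominator of the remaining
variables. -/
theorem coeff_mul_evSym_laurentPair (b : MvLaurent R l) (n : ℤ) (e : Fin l → ℤ)
    (f : (Fock R)[T;T⁻¹]) :
    (b * evSym R l (laurentPair (negCreationExp R) n f)).coeff e =
      (mvEmbed R l b * (∏ i ∈ Finset.range l,
      ((1 - mvT R (l + 1) 0 1 * mvEmbed R l (mvT R l i 1)) *
        (1 - mvT R (l + 1) 0 1 * mvEmbed R l (mvT R l i (-1))))) * evFirst R l f).coeff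
        (Fin.cons (α := fun _ => ℤ) n e) := by
  induction f using LaurentPolynomial.induction_on' with
  | add f g hf hg =>
    rw [map_add, map_add, map_add, mul_add, mul_add, AddMonoidAlgebra.coeff_add,
      AddMonoidAlgebra.coeff_add, Finsupp.add_apply, Finsupp.add_apply, hf, hg]
  | C_mul_T i a =>
    rw [← LaurentPolynomial.smul_eq_C_mul, map_smul, laurentPair_T, smul_eq_mul, map_mul,
      ← mul_assoc, LaurentPolynomial.smul_eq_C_mul, evFirst_C_mul_T]
    have h := zcoeff_map (evSym R l).toRingHom (negCreationExp R) (n - i)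
    rw [map_evSym_negCreationExp] at h
    have h' : evSym R l (zcoeff (negCreationExp R) (n - i)) =
        (evSym R l).toRingHom (zcoeff (negCreationExp R) (n - i)) := rfl
    rw [h', ← h, ← sameExpansion_prod, map_mul, ← coeff_mvT_zero_mul_cons]
    congr 2
    ring

/-- The operator applied first owns the variable z_0; the induction hypothesis treats the others,
and `weylDen_succ` collects the factors. -/
theorem foldl_vertexUStar (α : Fin l → ℤ) (v : Fock R) :
    MvPolynomial.constantCoeff ((List.ofFn α).foldl (fun w m => vertexUStar (-m) w) v) =
      (weylDen R l * evSym R l v).coeff fun k => -α k := by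
  induction l generalizing v with
  | zero =>
    have h1 : evSym R 0 v = AddMonoidAlgebra.single 0 (MvPolynomial.constantCoeff v) := by
      simp only [evSym, Finset.range_zero, Finset.sum_empty]
      exact MvPolynomial.aeval_zero' v
    have h2 : weylDen R 0 = 1 := by simp [weylDen, diffProd]
    have h3 : (fun k => -α k) = 0 := Subsingleton.elim _ _
    rw [h1, h2, one_mul, h3, AddMonoidAlgebra.coeff_single, Finsupp.single_eq_same]
    simp
  | succ l ih =>
    rw [List.ofFn_succ, List.foldl_cons, ih, vertexUStar_eq, coeff_mul_evSym_laurentPair, map_mul,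
      evFirst_expAnnihilation, map_sub, map_one, evFirst_T, weylDen_succ]
    congr 2
    · ring
    · funext i
      refine Fin.cases ?_ (fun i => ?_) i <;> simp

theorem bra_eq_coeff (mu : GenPartition l) (v : Fock R) :
    bra mu v = (weylDen R l * evSym R l v).coeff fun k => -(mu.1 k : ℤ) := by
  rw [bra, bind_ofFn_coe, foldl_vertexUStar]

end MultivariateLaurent

/-! ### The Weyl type formula and the skew characters. -/

section WeylFormula

open LaurentPolynomial (T)

variable {R : Type*} [CommRing R] {l : ℕ}

/-- The substitution `T ↦ z_k`. -/
def mvIncl (R : Type*) [CommRing R] (l k : ℕ) : R[T;T⁻¹] →+* MvLaurent R l :=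
  AddMonoidAlgebra.mapDomainRingHom R
    { toFun := fun n => fun i : Fin l => if (i : ℕ) = k then n else 0
      map_zero' := by funext i; simp
      map_add' := fun a b => by funext i; rw [Pi.add_apply]; split_ifs <;> simp }

theorem mvIncl_single (k : ℕ) (n : ℤ) (r : R) : mvIncl R l k (AddMonoidAlgebra.single n r) =
    AddMonoidAlgebra.single (fun i : Fin l => if (i : ℕ) = k then n else 0) r :=
  AddMonoidAlgebra.mapDomain_single

theorem mvIncl_T (k : ℕ) (n : ℤ) : mvIncl R l k (T n) = mvT R l k n :=
  mvIncl_single k n 1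

theorem mvIncl_C (k : ℕ) (r : R) :
    mvIncl R l k (LaurentPolynomial.C r) = algebraMap R (MvLaurent R l) r := by
  refine (mvIncl_single k 0 r).trans ?_
  simp only [ite_self]
  rfl

theorem mvEmbed_mvIncl (k : ℕ) (f : R[T;T⁻¹]) :
    mvEmbed R l (mvIncl R l k f) = mvIncl R (l + 1) (k + 1) f := by
  induction f using AddMonoidAlgebra.induction_linear with
  | zero => simp
  | add f g hf hg => simp only [map_add, hf, hg]
  | single n r =>
    rw [mvIncl_single, mvEmbed_single, mvIncl_single]
    congr 1
    funext i
    refine Fin.cases ?_ (fun i => ?_) i <;> simp [consZero]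

theorem coeff_mvIncl_mul_mvEmbed (f : R[T;T⁻¹]) (b : MvLaurent R l) (n : ℤ) (e : Fin l → ℤ) :
    (mvIncl R (l + 1) 0 f * mvEmbed R l b).coeff (Fin.cons (α := fun _ => ℤ) n e) =
      f.coeff n * b.coeff e := by
  induction f using LaurentPolynomial.induction_on' with
  | add f g hf hg =>
    rw [map_add, add_mul, AddMonoidAlgebra.coeff_add, AddMonoidAlgebra.coeff_add,
      Finsupp.add_apply, Finsupp.add_apply, hf, hg, add_mul]
  | C_mul_T i a =>
    rw [map_mul, mvIncl_C, mvIncl_T, mul_assoc, ← Algebra.smul_def, AddMonoidAlgebra.coeff_smul,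
      Finsupp.smul_apply, coeff_mvT_zero_mul_cons, coeff_mvEmbed,
      ← LaurentPolynomial.single_eq_C_mul_T, AddMonoidAlgebra.coeff_single, Finsupp.single_apply]
    by_cases h : n = i
    · simp [h]
    · rw [if_neg (sub_ne_zero.2 h), if_neg (Ne.symm h)]
      simp

theorem coeff_prod_mvIncl (f : Fin l → R[T;T⁻¹]) (e : Fin l → ℤ) :
    (∏ k : Fin l, mvIncl R l k (f k)).coeff e = ∏ k, (f k).coeff (e k) := by
  induction l with
  | zero =>
    have h : e = 0 := Subsingleton.elim _ _
    rw [h, Fin.prod_univ_zero, Fin.prod_univ_zero, AddMonoidAlgebra.one_def,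
      AddMonoidAlgebra.coeff_single, Finsupp.single_eq_same]
  | succ l ih =>
    rw [Fin.prod_univ_succ, Fin.prod_univ_succ, ← ih, ← coeff_mvIncl_mul_mvEmbed, map_prod]
    congr 2
    · congr 1
      refine Finset.prod_congr rfl fun k _ => ?_
      rw [mvEmbed_mvIncl, Fin.val_succ]
    · exact (Fin.cons_self_tail e).symm

/-- Coefficient extraction as a linear map. -/
def mvCoeff (e : Fin l → ℤ) : MvLaurent R l →ₗ[R] R where
  toFun f := f.coeff e
  map_add' _ _ := rfl
  map_smul' _ _ := rfl

/-- In each Leibniz term the variables are separated by columns, so the coefficient of a monomial is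
a product of one-variable coefficients. -/
theorem coeff_det_mvIncl {N : ℕ} (U : Fin (l + N) → Fin l → R[T;T⁻¹]) (c : Fin (l + N) → Fin N → R)
    (M : Matrix (Fin (l + N)) (Fin (l + N)) (MvLaurent R l))
    (hU : ∀ i j, M i (Fin.castAdd N j) = mvIncl R l j (U i j))
    (hc : ∀ i j, M i (Fin.natAdd l j) = algebraMap R _ (c i j)) (e : Fin l → ℤ) :
    M.det.coeff e = (Matrix.of fun i => Fin.append (fun j => (U i j).coeff (e j)) (c i)).det := by
  have h : M.det.coeff e = mvCoeff e M.det := rfl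
  rw [h, Matrix.det_apply, Matrix.det_apply, map_sum]
  refine Finset.sum_congr rfl fun σ _ => ?_
  rw [Units.smul_def, map_zsmul, ← Units.smul_def]
  congr 1
  rw [Fin.prod_univ_add, Fin.prod_univ_add]
  simp only [hU, hc, Matrix.of_apply, Fin.append_left, Fin.append_right]
  rw [← map_prod, mul_comm, ← Algebra.smul_def, map_smul, smul_eq_mul, mul_comm]
  congr 1
  exact coeff_prod_mvIncl _ e

theorem coeff_geomFactor {A : Type*} [CommRing A] (u : A) (n : ℕ) :
    PowerSeries.coeff n (geomFactor u) = u ^ n := by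
  have h := linFactor_mul_geomFactor u
  induction n with
  | zero => simp [geomFactor]
  | succ n ih =>
    have h1 := congrArg (PowerSeries.coeff (n + 1)) h
    rw [linFactor, sub_mul, one_mul, mul_assoc, map_sub, PowerSeries.coeff_C_mul,
      PowerSeries.coeff_succ_X_mul, ih, PowerSeries.coeff_one, if_neg (Nat.succ_ne_zero n)] at h1
    rw [pow_succ']
    exact sub_eq_zero.1 h1

/-- The coefficient of `t ^ e` in `(1 / (1 - t T⁻¹) - T / (1 - t T)) G (t)`. -/
def weylEntry (G : PowerSeries R) (e : ℤ) : R[T;T⁻¹] :=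
  zcoeff ((geomFactor (T (-1)) - PowerSeries.C (T 1) * geomFactor (T 1)) *
    PowerSeries.map LaurentPolynomial.C G) e

/-- The second summand contains only positive powers of T, so at exponents -s with s ≥ 0 only 1 / (1
- t T⁻¹) contributes. -/
theorem coeff_weylEntry (G : PowerSeries R) (e : ℤ) (s : ℕ) :
    (weylEntry G e).coeff (-s) = zcoeff G (e - s) := by
  rcases lt_or_ge e 0 with he | he
  · rw [weylEntry, zcoeff_of_neg _ he, zcoeff_of_neg _ (by omega)]
    rfl
  lift e to ℕ using he
  rw [weylEntry, zcoeff_natCast, sub_mul, map_sub, mul_assoc, PowerSeries.coeff_C_mul,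
    PowerSeries.coeff_mul, PowerSeries.coeff_mul, Finset.mul_sum, AddMonoidAlgebra.coeff_sub,
    AddMonoidAlgebra.coeff_sum, AddMonoidAlgebra.coeff_sum, Finsupp.sub_apply,
    Finsupp.finsetSum_apply, Finsupp.finsetSum_apply]
  have h1 : ∀ x : ℕ × ℕ, (T 1 * (PowerSeries.coeff x.1 (geomFactor (T 1 : R[T;T⁻¹])) *
      PowerSeries.coeff x.2 (PowerSeries.map LaurentPolynomial.C G))).coeff (-(s : ℤ)) = 0 := by
    intro x
    rw [coeff_geomFactor, PowerSeries.coeff_map, LaurentPolynomial.T_pow, ← mul_assoc,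
      ← LaurentPolynomial.T_add, mul_comm, ← LaurentPolynomial.single_eq_C_mul_T,
      AddMonoidAlgebra.coeff_single, Finsupp.single_apply, if_neg (by omega)]
  have h2 : ∀ x : ℕ × ℕ, (PowerSeries.coeff x.1 (geomFactor (T (-1) : R[T;T⁻¹])) *
      PowerSeries.coeff x.2 (PowerSeries.map LaurentPolynomial.C G)).coeff (-(s : ℤ)) =
      if x.1 = s then PowerSeries.coeff x.2 G else 0 := by
    intro x
    rw [coeff_geomFactor, PowerSeries.coeff_map, LaurentPolynomial.T_pow,
      mul_comm, ← LaurentPolynomial.single_eq_C_mul_T,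
      AddMonoidAlgebra.coeff_single, Finsupp.single_apply]
    refine if_congr ?_ rfl rfl
    omega
  simp only [h1, h2, Finset.sum_const_zero, sub_zero]
  rw [Finset.Nat.sum_antidiagonal_eq_sum_range_succ_mk]
  simp only [Finset.sum_ite_eq', Finset.mem_range]
  split_ifs with h
  · rw [← Nat.cast_sub (by omega), zcoeff_natCast]
  · rw [zcoeff_of_neg _ (by omega)]

/-- Partial fractions: (1 - z)(1 + t) / ((1 - zt)(1 - t/z)) = 1 / (1 - t/z) - z / (1 - zt). -/
theorem jtFun_geomFactor_one {A : Type*} [CommRing A] {z z' : A} (h : z * z' = 1)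
    (G : PowerSeries A) (e : ℤ) : (1 - z) * jtFun (geomFactor z * geomFactor z' * G) e 1 =
      zcoeff ((geomFactor z' - PowerSeries.C z * geomFactor z) * G) e := by
  have h1 : (geomFactor z' - PowerSeries.C z * geomFactor z) * G =
      PowerSeries.C (1 - z) * ((1 + PowerSeries.X) * (geomFactor z * geomFactor z' * G)) := by
    have e1 := linFactor_mul_geomFactor z
    have e2 := linFactor_mul_geomFactor z'
    have e3 : (PowerSeries.C z * PowerSeries.C z' : PowerSeries A) = 1 := by
      rw [← map_mul, h, map_one]
    rw [map_sub, map_one]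
    unfold linFactor at e1 e2
    linear_combination (-geomFactor z' * G) * e1 + (PowerSeries.C z * geomFactor z * G) * e2 +
      geomFactor z * geomFactor z' * G * PowerSeries.X * e3
  rw [h1, zcoeff_C_mul, add_mul, one_mul, zcoeff_add, zcoeff_X_mul, jtFun_one]

/-- The series `∏_k 1 / ((1 - z_k t) (1 - z_k⁻¹ t))`. -/
def mvGeom (R : Type*) [CommRing R] (l : ℕ) : PowerSeries (MvLaurent R l) :=
  ∏ k ∈ Finset.range l, (geomFactor (mvT R l k 1) * geomFactor (mvT R l k (-1)))

theorem linFactor_prod_mul_mvGeom :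
    (∏ k ∈ Finset.range l, (linFactor (mvT R l k 1) * linFactor (mvT R l k (-1)))) *
      mvGeom R l = 1 := by
  rw [mvGeom, ← Finset.prod_mul_distrib]
  refine Finset.prod_eq_one fun k _ => ?_
  rw [mul_mul_mul_comm, linFactor_mul_geomFactor, linFactor_mul_geomFactor, one_mul]

theorem linFactor_prod_erase_mul_mvGeom {k : ℕ} (hk : k ∈ Finset.range l) :
    (∏ k ∈ (Finset.range l).erase k, (linFactor (mvT R l k 1) * linFactor (mvT R l k (-1)))) *
      mvGeom R l = geomFactor (mvT R l k 1) * geomFactor (mvT R l k (-1)) := by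
  rw [mvGeom, ← Finset.mul_prod_erase _ _ hk, mul_left_comm, ← Finset.prod_mul_distrib,
    Finset.prod_eq_one, mul_one]
  intro i _
  rw [mul_mul_mul_comm, linFactor_mul_geomFactor, linFactor_mul_geomFactor, one_mul]

theorem map_mvIncl_C (k : ℕ) (G : PowerSeries R) :
    PowerSeries.map (mvIncl R l k) (PowerSeries.map LaurentPolynomial.C G) =
      PowerSeries.map (algebraMap R (MvLaurent R l)) G := by
  ext n : 1
  simp only [PowerSeries.coeff_map, mvIncl_C]

/-- The Weyl type formula for the product of the denominator and a Jacobi–Trudi determinant. -/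
theorem weylDen_mul_det {m : ℕ} (hl : l ≤ m) (G : PowerSeries R) (e : Fin m → ℤ) :
    weylDen R l * (Matrix.of fun i j : Fin m =>
      jtFun (mvGeom R l * PowerSeries.map (algebraMap R (MvLaurent R l)) G) (e i)
        (oddPoly (MvLaurent R l) j)).det =
    (Matrix.of fun i j : Fin m => if (j : ℕ) < l then
      mvIncl R l j (T (l - 1 - (j : ℕ)) * weylEntry G (e i + l - 1)) else
      algebraMap R (MvLaurent R l) (zcoeff G (e i + j) + zcoeff G (e i + 2 * l - 1 - j))).det := by
  nontriviality (MvLaurent R l)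
  set Ĝ := PowerSeries.map (algebraMap R (MvLaurent R l)) G with hĜ
  let c : ℕ → MvLaurent R l := fun k => (1 - mvT R l k 1) * mvT R l k (l - 1 - k)
  have hcol : ∏ k ∈ Finset.range l, c k = ∏ j : Fin m, if (j : ℕ) < l then c j else 1 := by
    rw [Fin.prod_univ_eq_prod_range (fun j => if j < l then c j else 1) m]
    rw [← Finset.prod_subset (Finset.range_subset_range.2 hl)]
    · exact Finset.prod_congr rfl fun k hk => (if_pos (Finset.mem_range.1 hk)).symm
    · intro k _ hk
      exact if_neg fun h => hk (Finset.mem_range.2 h)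
  rw [weylDen, hcol, mul_assoc,
    det_apply_monic (fun i => jtFun (mvGeom R l * Ĝ) (e i)) _
      (fun j => (oddPoly_degree j).2) (fun j => (oddPoly_degree j).1),
    diffProd_mul_det hl (mvSym R l) _ (fun j => (oddPoly_degree j).2)
      (fun j => (oddPoly_degree j).1), ← Matrix.det_mul_row]
  congr 1
  ext1 i j
  simp only [Matrix.of_apply]
  have hu : ∀ k, mvT R l k 1 * mvT R l k (-1) = 1 := fun k => mvT_mul_neg k 1
  split_ifs with hj
  -- The Lagrange product over k ≠ j cancels every geometric factor of `mvGeom` except those of z_j,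
  -- and its l - 1 factors shift the index by l - 1.
  · have hmem : (j : ℕ) ∈ Finset.range l := Finset.mem_range.2 hj
    have h1 : lagrangeFamily (mvSym R l) (oddPoly (MvLaurent R l)) l j =
        (∏ k ∈ (Finset.range l).erase j,
          (Polynomial.X - Polynomial.C (mvT R l k 1 + mvT R l k (-1)))) * 1 := by
      rw [lagrangeFamily, if_pos hj, ← Finset.mul_prod_erase _ _ hmem, if_pos rfl, one_mul, mul_one]
      exact Finset.prod_congr rfl fun k hk => if_neg (Finset.mem_erase.1 hk).1
    rw [h1, jtFun_prod_mul _ _ _ _ _ hu, ← mul_assoc, linFactor_prod_erase_mul_mvGeom hmem,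
      mul_right_comm, jtFun_geomFactor_one (hu j), Finset.card_erase_of_mem hmem,
      Finset.card_range, map_mul, mvIncl_T, mul_comm, weylEntry, ← zcoeff_map, map_mul, map_sub,
      map_mul, PowerSeries.map_C, map_geomFactor, map_geomFactor, mvIncl_T, mvIncl_T,
      map_mvIncl_C, Nat.cast_sub (by omega), Nat.cast_one, add_sub_assoc]
  -- Beyond column l all geometric factors cancel; B_{j-l} with index shift l gives e + j and e + 2l
  -- - 1 - j.
  · rw [lagrangeFamily, if_neg hj, one_mul]
    simp only [mvSym]
    rw [jtFun_prod_mul _ _ _ _ _ hu, ← mul_assoc, linFactor_prod_mul_mvGeom, one_mul,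
      jtFun_oddPoly, hĜ, zcoeff_map, zcoeff_map, ← map_add, Finset.card_range]
    rw [Nat.cast_sub (by omega)]
    congr 3 <;> ring

theorem isExp_hSeries {N : ℕ} (x : Fin N → Rˣ) :
    IsExp (fun n => ∑ i, ((x i : R) ^ (n : ℕ) + (((x i)⁻¹ : Rˣ) : R) ^ (n : ℕ))) (hSeries x) :=
  IsExp.prod Finset.univ fun i =>
    (IsExp.geomFactor (x i : R)).mul (IsExp.geomFactor (((x i)⁻¹ : Rˣ) : R))

theorem hPM_eq {N : ℕ} (x : Fin N → Rˣ) (n : ℤ) : hPM x n = zcoeff (hSeries x) n := rfl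

theorem isExp_mvGeom : IsExp (fun n => ∑ k ∈ Finset.range l,
    (mvT R l k (n : ℕ) + mvT R l k (-(n : ℕ)))) (mvGeom R l) := by
  have h := IsExp.prod (Finset.range l) fun k =>
    (IsExp.geomFactor (mvT R l k 1)).mul (IsExp.geomFactor (mvT R l k (-1)))
  simpa only [mvGeom, mvT_pow, mul_one, mul_neg] using h

theorem gammaPlus_X {N : ℕ} (x : Fin N → Rˣ) (n : ℕ+) :
    gammaPlus x (MvPolynomial.X n) = MvPolynomial.X n + MvPolynomial.C
      (∑ i, ((x i : R) ^ (n : ℕ) + (((x i)⁻¹ : Rˣ) : R) ^ (n : ℕ))) :=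
  expAnnihilation_X _ n

theorem map_evSym_C (G : PowerSeries R) :
    PowerSeries.map (evSym R l).toRingHom (PowerSeries.map MvPolynomial.C G) =
      PowerSeries.map (algebraMap R (MvLaurent R l)) G := by
  ext n : 1
  simp only [PowerSeries.coeff_map]
  exact (evSym R l).commutes _

theorem coeff_T_mul (n s : ℤ) (f : R[T;T⁻¹]) : (T n * f).coeff s = f.coeff (s - n) := by
  rw [T, AddMonoidAlgebra.coeff_single_mul_eq_mul_coeff (s - n), one_mul]
  intro m _
  constructor <;> intro h <;> omega

variable [Algebra ℚ R]

theorem map_gammaPlus_creationExp {N : ℕ} (x : Fin N → Rˣ) :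
    PowerSeries.map (gammaPlus x).toRingHom (creationExp R) =
      creationExp R * PowerSeries.map MvPolynomial.C (hSeries x) := by
  have h1 := (isExp_creationExp R).map (gammaPlus x).toRingHom
  have h2 := (isExp_creationExp R).mul ((isExp_hSeries x).map (MvPolynomial.C (σ := ℕ+)))
  refine IsExp.unique (p := _) h1 ?_
  convert h2 using 2 with n
  exact gammaPlus_X x n

theorem map_evSym_creationExp :
    PowerSeries.map (evSym R l).toRingHom (creationExp R) = mvGeom R l := by
  have h1 := (isExp_creationExp R).map (evSym R l).toRingHom
  refine IsExp.unique (p := _) h1 ?_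
  convert isExp_mvGeom using 2 with n
  exact evSym_X n

theorem evSym_gammaPlus_ket {N m : ℕ} (x : Fin N → Rˣ) (lam : GenPartition m) :
    evSym R l (gammaPlus x (ket lam)) = (Matrix.of fun i j : Fin m =>
      jtFun (mvGeom R l * PowerSeries.map (algebraMap R (MvLaurent R l)) (hSeries x))
        ((lam.1 i : ℤ) - (i : ℤ)) (oddPoly (MvLaurent R l) j)).det := by
  have h1 : gammaPlus x (ket lam) = (Matrix.of fun i j : Fin m =>
      jtFun (PowerSeries.map (gammaPlus x).toRingHom (creationExp R))
        ((lam.1 i : ℤ) - (i : ℤ)) (oddPoly (Fock R) j)).det := by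
    rw [ket_eq_det]
    exact map_det_jtFun (gammaPlus x).toRingHom _ _
  rw [h1]
  refine (map_det_jtFun (evSym R l).toRingHom _ _).trans ?_
  rw [map_gammaPlus_creationExp, map_mul, map_evSym_creationExp, map_evSym_C]

theorem gammaPlusCoeff_eq_skewSO {N : ℕ} (x : Fin N → Rˣ) (tau : GenPartition l)
    (rho : GenPartition (l + N)) : gammaPlusCoeff x tau rho = skewSO x rho tau := by
  rw [gammaPlusCoeff, bra_eq_coeff, evSym_gammaPlus_ket,
    weylDen_mul_det (Nat.le_add_right l N),
    coeff_det_mvIncl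
      (fun i j => T (l - 1 - (j : ℕ)) * weylEntry (hSeries x) ((rho.1 i : ℤ) - (i : ℤ) + l - 1))
      (fun i j => zcoeff (hSeries x) ((rho.1 i : ℤ) - (i : ℤ) + (l + j : ℕ)) +
        zcoeff (hSeries x) ((rho.1 i : ℤ) - (i : ℤ) + 2 * l - 1 - (l + j : ℕ))), skewSO]
  · congr 1
    ext i j
    simp only [Matrix.of_apply]
    refine Fin.addCases (fun j => ?_) (fun j => ?_) j
    -- After removing T^{l-1-j} the required exponent is nonpositive, because tau_j ≥ 0 and j ≤ l -
    -- 1; this is the range of `coeff_weylEntry`.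
    · have hs : -(tau.1 j : ℤ) - (l - 1 - (j : ℕ)) = -((tau.1 j + (l - 1 - j) : ℕ) : ℤ) := by
        have := j.2
        omega
      rw [Fin.append_left, dif_pos (by simp), coeff_T_mul, hs, coeff_weylEntry, hPM_eq]
      congr 1
      have := j.2
      simp only [Fin.val_castAdd, Fin.eta]
      push_cast [Nat.cast_sub (show (j : ℕ) ≤ l - 1 by omega), Nat.cast_sub (show 1 ≤ l by omega)]
      ring
    · rw [Fin.append_right, dif_neg (by simp), hPM_eq, hPM_eq]
      congr 2 <;> · simp only [Fin.val_natAdd]; push_cast; ring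
  · intro i j
    simp
  · intro i j
    simp

end WeylFormula

/-! ### Products of power series in separate variables. -/

section ProductSeries

variable {A B : Type*} [CommRing A] [CommRing B] {K : ℕ}

theorem prod_coeff_mul (F G : Fin K → PowerSeries A) (d : Fin K →₀ ℕ) :
    ∏ j, PowerSeries.coeff (d j) (F j * G j) = ∑ p ∈ Finset.HasAntidiagonal.antidiagonal d,
      (∏ j, PowerSeries.coeff (p.1 j) (F j)) * ∏ j, PowerSeries.coeff (p.2 j) (G j) := by
  simp only [PowerSeries.coeff_mul]
  rw [Finset.prod_univ_sum]
  refine Finset.sum_bij'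
    (fun x _ => (Finsupp.equivFunOnFinite.symm fun j => (x j).1,
      Finsupp.equivFunOnFinite.symm fun j => (x j).2))
    (fun p _ j => (p.1 j, p.2 j)) ?_ ?_ ?_ ?_ ?_
  · intro x hx
    rw [Finset.HasAntidiagonal.mem_antidiagonal]
    ext j
    exact Finset.HasAntidiagonal.mem_antidiagonal.1 (Fintype.mem_piFinset.1 hx j)
  · intro p hp
    rw [Fintype.mem_piFinset]
    intro j
    rw [Finset.HasAntidiagonal.mem_antidiagonal]
    exact DFunLike.congr_fun (Finset.HasAntidiagonal.mem_antidiagonal.1 hp) j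
  · intro x _
    rfl
  · intro p _
    ext j <;> rfl
  · intro x _
    exact Finset.prod_mul_distrib

/-- The product `∏_j F_j (y_j)` of power series in separate variables. -/
def prodSeries (A : Type*) [CommRing A] (K : ℕ) :
    (Fin K → PowerSeries A) →* MvPowerSeries (Fin K) A where
  toFun F := fun d => ∏ j, PowerSeries.coeff (d j) (F j)
  map_one' := by
    classical
    funext d
    change ∏ j : Fin K, PowerSeries.coeff (d j) (1 : PowerSeries A) = MvPowerSeries.coeff d 1
    rw [MvPowerSeries.coeff_one]
    simp only [PowerSeries.coeff_one]
    by_cases h : d = 0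
    · simp [h]
    · rw [if_neg h]
      obtain ⟨j, hj⟩ := Finsupp.ne_iff.1 h
      exact Finset.prod_eq_zero (Finset.mem_univ j) (if_neg hj)
  map_mul' F G := by
    classical
    funext d
    exact (prod_coeff_mul F G d).trans (MvPowerSeries.coeff_mul (σ := Fin K) (R := A) d
      (fun d => ∏ j, PowerSeries.coeff (d j) (F j))
      fun d => ∏ j, PowerSeries.coeff (d j) (G j)).symm

theorem coeff_prodSeries (F : Fin K → PowerSeries A) (d : Fin K →₀ ℕ) :
    MvPowerSeries.coeff d (prodSeries A K F) = ∏ j, PowerSeries.coeff (d j) (F j) := rfl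

theorem map_prodSeries (f : A →+* B) (F : Fin K → PowerSeries A) :
    MvPowerSeries.map f (prodSeries A K F) = prodSeries B K fun j => PowerSeries.map f (F j) := by
  ext d
  simp [coeff_prodSeries]

theorem coeff_prodSeries_mulSingle (j : Fin K) (F : PowerSeries A) (d : Fin K →₀ ℕ) :
    MvPowerSeries.coeff d (prodSeries A K (Pi.mulSingle j F)) =
      if d = Finsupp.single j (d j) then PowerSeries.coeff (d j) F else 0 := by
  classical
  rw [coeff_prodSeries]
  split_ifs with h
  · rw [Finset.prod_eq_single j, Pi.mulSingle_eq_same]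
    · intro i _ hi
      have : d i = 0 := by rw [h, Finsupp.single_apply, if_neg hi.symm]
      rw [Pi.mulSingle_eq_of_ne hi, this]
      simp
    · simp
  · obtain ⟨i, hi⟩ := Finsupp.ne_iff.1 h
    have hij : i ≠ j := by
      rintro rfl
      simp at hi
    rw [Finsupp.single_apply, if_neg hij.symm] at hi
    refine Finset.prod_eq_zero (Finset.mem_univ i) ?_
    rw [Pi.mulSingle_eq_of_ne hij, PowerSeries.coeff_one, if_neg hi]

theorem prodSeries_linFactor (j : Fin K) (u : A) :
    prodSeries A K (Pi.mulSingle j (linFactor u)) =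
      1 - MvPowerSeries.C u * MvPowerSeries.X j := by
  classical
  ext d
  rw [coeff_prodSeries_mulSingle, map_sub, MvPowerSeries.coeff_C_mul, MvPowerSeries.coeff_one,
    MvPowerSeries.coeff_X, linFactor, map_sub, PowerSeries.coeff_C_mul, PowerSeries.coeff_one,
    PowerSeries.coeff_X]
  by_cases h : d = Finsupp.single j (d j)
  · rw [if_pos h]
    have h0 : d = 0 ↔ d j = 0 := by
      constructor
      · intro h'; rw [h']; rfl
      · intro h'; rw [h, h', Finsupp.single_zero]
    have h1 : d = Finsupp.single j 1 ↔ d j = 1 := by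
      constructor
      · intro h'; rw [h', Finsupp.single_eq_same]
      · intro h'; rw [h, h']
    simp only [h0, h1]
  · rw [if_neg h, if_neg, if_neg]
    · simp
    · intro h'
      exact h (by rw [h', Finsupp.single_eq_same])
    · rintro rfl
      exact h (by simp)

theorem prodSeries_geomFactor (j : Fin K) (u : A) :
    MvPowerSeries.invOfUnit (1 - MvPowerSeries.C u * MvPowerSeries.X j) 1 =
      prodSeries A K (Pi.mulSingle j (geomFactor u)) := by
  have h1 : (1 - MvPowerSeries.C u * MvPowerSeries.X j : MvPowerSeries (Fin K) A) *
      MvPowerSeries.invOfUnit (1 - MvPowerSeries.C u * MvPowerSeries.X j) 1 = 1 :=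
    MvPowerSeries.mul_invOfUnit _ _ (by simp)
  have h2 : prodSeries A K (Pi.mulSingle j (geomFactor u)) *
      (1 - MvPowerSeries.C u * MvPowerSeries.X j) = 1 := by
    rw [← prodSeries_linFactor, ← map_mul, ← Pi.mulSingle_mul, mul_comm,
      linFactor_mul_geomFactor, Pi.mulSingle_one, map_one]
  exact (left_inv_eq_right_inv h2 h1).symm

theorem prod_prodSeries_mulSingle (F : Fin K → PowerSeries A) :
    ∏ j, prodSeries A K (Pi.mulSingle j (F j)) = prodSeries A K F := by
  rw [← map_prod, Finset.univ_prod_mulSingle]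

theorem fSeries_eq (R : Type*) [CommRing R] (K : ℕ) : fSeries R K =
    prodSeries R[T;T⁻¹] K fun _ =>
      geomFactor (LaurentPolynomial.T 1) * geomFactor (LaurentPolynomial.T (-1)) := by
  rw [fSeries, ← prod_prodSeries_mulSingle]
  refine Finset.prod_congr rfl fun j _ => ?_
  rw [prodSeries_geomFactor, prodSeries_geomFactor, ← map_mul, ← Pi.mulSingle_mul]

theorem cauchyKernel_eq {N : ℕ} (K : ℕ) (x : Fin N → Aˣ) :
    cauchyKernel K x = prodSeries A K fun _ => hSeries x := by
  have h : (fun _ : Fin K => hSeries x) = ∏ i, fun _ : Fin K =>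
      geomFactor (x i : A) * geomFactor (((x i)⁻¹ : Aˣ) : A) := by
    funext j
    rw [Finset.prod_apply]
    rfl
  rw [h, map_prod, cauchyKernel]
  refine Finset.prod_congr rfl fun i _ => ?_
  rw [← prod_prodSeries_mulSingle]
  refine Finset.prod_congr rfl fun j _ => ?_
  rw [prodSeries_geomFactor, prodSeries_geomFactor, ← map_mul, ← Pi.mulSingle_mul]

/-- Applying an additive map to all coefficients. -/
def mapCoeff (σ : Type*) (φ : A →+ B) : MvPowerSeries σ A →+ MvPowerSeries σ B where
  toFun F := fun d => φ (MvPowerSeries.coeff d F)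
  map_zero' := by funext d; simp; rfl
  map_add' F G := by funext d; simp; rfl

theorem coeff_mapCoeff {σ : Type*} (φ : A →+ B) (F : MvPowerSeries σ A) (d : σ →₀ ℕ) :
    MvPowerSeries.coeff d (mapCoeff σ φ F) = φ (MvPowerSeries.coeff d F) := rfl

end ProductSeries

/-! ### Matrix coefficients of Γ_-(y) and the dual characters. -/

section DualCharacters

open LaurentPolynomial (T)

variable {R : Type*} [CommRing R] {l K : ℕ}

/-- Coefficient extraction for Laurent polynomials in one variable. -/
def laurentCoeff (R : Type*) [CommRing R] (n : ℤ) : R[T;T⁻¹] →+ R where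
  toFun f := f.coeff n
  map_zero' := rfl
  map_add' _ _ := rfl

theorem fCoeff_eq (n : ℤ) : fCoeff R K n = mapCoeff (Fin K) (laurentCoeff R n) (fSeries R K) := rfl

/-- The generating series is invariant under z ↦ z⁻¹. -/
theorem fCoeff_neg (n : ℤ) : fCoeff R K (-n) = fCoeff R K n := by
  have h : MvPowerSeries.map (LaurentPolynomial.invert (R := R)).toRingEquiv.toRingHom
      (fSeries R K) = fSeries R K := by
    rw [fSeries_eq, map_prodSeries]
    congr 1
    funext _
    rw [map_mul, map_geomFactor, map_geomFactor, mul_comm]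
    congr 2
    · exact LaurentPolynomial.invert_T (-1)
    · exact LaurentPolynomial.invert_T 1
  funext d
  have h1 := congrArg (fun F => (MvPowerSeries.coeff d F).coeff n) h
  simp only [MvPowerSeries.coeff_map] at h1
  exact (LaurentPolynomial.invert_apply _ _).symm.trans h1

theorem mapCoeff_prod_mvIncl (F : Fin l → MvPowerSeries (Fin K) R[T;T⁻¹]) (e : Fin l → ℤ) :
    mapCoeff (Fin K) (mvCoeff e).toAddMonoidHom
        (∏ k : Fin l, MvPowerSeries.map (mvIncl R l k) (F k)) =
      ∏ k, mapCoeff (Fin K) (laurentCoeff R (e k)) (F k) := by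
  classical
  ext d
  rw [coeff_mapCoeff, MvPowerSeries.coeff_prod, MvPowerSeries.coeff_prod, map_sum]
  refine Finset.sum_congr rfl fun p _ => ?_
  simp only [MvPowerSeries.coeff_map, coeff_mapCoeff]
  exact coeff_prod_mvIncl _ e

theorem mapCoeff_C_T_mul (s a : ℤ) (F : MvPowerSeries (Fin K) R[T;T⁻¹]) :
    mapCoeff (Fin K) (laurentCoeff R s) (MvPowerSeries.C (T a) * F) =
      mapCoeff (Fin K) (laurentCoeff R (s - a)) F := by
  ext d
  rw [coeff_mapCoeff, coeff_mapCoeff, MvPowerSeries.coeff_C_mul]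
  exact coeff_T_mul a s _

theorem weylEntry_one (e : ℕ) : weylEntry (1 : PowerSeries R) e = T (-e) - T (e + 1) := by
  rw [weylEntry, map_one, mul_one, zcoeff_natCast, map_sub, PowerSeries.coeff_C_mul,
    coeff_geomFactor, coeff_geomFactor, LaurentPolynomial.T_pow, LaurentPolynomial.T_pow,
    ← LaurentPolynomial.T_add]
  congr 2 <;> ring

theorem prodSeries_mvGeom : prodSeries (MvLaurent R l) K (fun _ => mvGeom R l) =
    ∏ k : Fin l, MvPowerSeries.map (mvIncl R l k) (fSeries R K) := by
  have h : (fun _ : Fin K => mvGeom R l) = ∏ k : Fin l, fun _ : Fin K =>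
      geomFactor (mvT R l k 1) * geomFactor (mvT R l k (-1)) := by
    funext j
    rw [Finset.prod_apply, mvGeom]
    exact Finset.prod_range fun k => geomFactor (mvT R l k 1) * geomFactor (mvT R l k (-1))
  rw [h, map_prod]
  refine Finset.prod_congr rfl fun k _ => ?_
  rw [fSeries_eq, map_prodSeries]
  congr 1
  funext j
  rw [map_mul, map_geomFactor, map_geomFactor, mvIncl_T, mvIncl_T]

variable [Algebra ℚ R]

/-- The Weyl formula with trivial series G = 1 and no constant columns: every entry is a difference
of two monomials. -/
theorem weylDen_mul_evSym_ket (nu : GenPartition l) : weylDen R l * evSym R l (ket nu) =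
    (Matrix.of fun i j : Fin l => mvIncl R l j (T (l - 1 - (j : ℕ)) *
      (T (-(nu.1 i - i + l - 1)) - T (nu.1 i - i + l)))).det := by
  have h1 : evSym R l (ket nu) = (Matrix.of fun i j : Fin l =>
      jtFun (PowerSeries.map (evSym R l).toRingHom (creationExp R))
        ((nu.1 i : ℤ) - (i : ℤ)) (oddPoly (MvLaurent R l) j)).det := by
    rw [ket_eq_det]
    exact map_det_jtFun (evSym R l).toRingHom _ _
  have h2 := weylDen_mul_det le_rfl (1 : PowerSeries R) fun i : Fin l => (nu.1 i : ℤ) - (i : ℤ)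
  rw [map_one, mul_one] at h2
  rw [h1, map_evSym_creationExp, h2]
  congr 1
  ext1 i j
  simp only [Matrix.of_apply]
  rw [if_pos j.2]
  congr 2
  have h3 : (nu.1 i : ℤ) - (i : ℤ) + l - 1 = (nu.1 i + (l - 1 - i) : ℕ) := by
    have := i.2
    omega
  rw [h3, weylEntry_one, ← h3]
  congr 2
  ring

/-- The product of the coefficients of `y ^ d` in the factors of `Γ_-(y)`. -/
def creationMonomial (R : Type*) [CommRing R] [Algebra ℚ R] {K : ℕ} (d : Fin K →₀ ℕ) : Fock R :=
  ∏ j, expCreation R (d j : ℤ)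

theorem creationMonomial_eq (d : Fin K →₀ ℕ) : creationMonomial R d =
    MvPowerSeries.coeff d (prodSeries (Fock R) K fun _ => creationExp R) := by
  rw [creationMonomial, coeff_prodSeries]
  exact Finset.prod_congr rfl fun j _ => zcoeff_natCast _ _

theorem map_creationMonomial {A : Type*} [CommRing A] (f : Fock R →+* A) (d : Fin K →₀ ℕ) :
    f (creationMonomial R d) = MvPowerSeries.coeff d
      (prodSeries A K fun _ => PowerSeries.map f (creationExp R)) := by
  rw [creationMonomial_eq, ← map_prodSeries, MvPowerSeries.coeff_map]

theorem evSym_creationMonomial (d : Fin K →₀ ℕ) : evSym R l (creationMonomial R d) =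
    MvPowerSeries.coeff d (∏ k : Fin l, MvPowerSeries.map (mvIncl R l k) (fSeries R K)) := by
  rw [← prodSeries_mvGeom, ← map_evSym_creationExp]
  exact map_creationMonomial (evSym R l).toRingHom d

theorem coeff_gammaMinusCoeff {m : ℕ} (mu : GenPartition l) (nu : GenPartition m)
    (d : Fin K →₀ ℕ) : MvPowerSeries.coeff d (gammaMinusCoeff R K mu nu) =
      bra mu (creationMonomial R d * ket nu) := rfl

/-- Under `evSym` the series Γ_-(y) becomes ∏_k f(z_k; y), so each Leibniz term still factors over
the variables z_k, and each monomial in an entry contributes one f. -/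
theorem gammaMinusCoeff_eq_dualSO (mu nu : GenPartition l) :
    gammaMinusCoeff R K mu nu = dualSO R K mu nu := by
  have key : gammaMinusCoeff R K mu nu =
      mapCoeff (Fin K) (mvCoeff fun k => -(mu.1 k : ℤ)).toAddMonoidHom
        (MvPowerSeries.C (weylDen R l * evSym R l (ket nu)) *
          ∏ k : Fin l, MvPowerSeries.map (mvIncl R l k) (fSeries R K)) := by
    ext d
    rw [coeff_gammaMinusCoeff, coeff_mapCoeff, bra_eq_coeff, MvPowerSeries.coeff_C_mul,
      ← evSym_creationMonomial, map_mul, mul_comm (evSym R l (creationMonomial R d)), ← mul_assoc]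
    rfl
  rw [key, weylDen_mul_evSym_ket, dualSO, Matrix.det_apply, Matrix.det_apply, map_sum,
    Finset.sum_mul, map_sum]
  refine Finset.sum_congr rfl fun σ _ => ?_
  rw [Units.smul_def, Units.smul_def, map_zsmul, smul_mul_assoc, map_zsmul, map_prod,
    ← Finset.prod_mul_distrib]
  congr 1
  have h : ∀ k : Fin l, MvPowerSeries.C (mvIncl R l k (T (l - 1 - (k : ℕ)) *
      (T (-(nu.1 (σ k) - (σ k : ℕ) + l - 1)) - T (nu.1 (σ k) - (σ k : ℕ) + l)))) *
      MvPowerSeries.map (mvIncl R l k) (fSeries R K) =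
      MvPowerSeries.map (mvIncl R l k) (MvPowerSeries.C (T (l - 1 - (k : ℕ)) *
      (T (-(nu.1 (σ k) - (σ k : ℕ) + l - 1)) - T (nu.1 (σ k) - (σ k : ℕ) + l))) *
        fSeries R K) := by
    intro k
    rw [map_mul (MvPowerSeries.map _), MvPowerSeries.map_C]
  simp only [Matrix.of_apply, h]
  rw [mapCoeff_prod_mvIncl]
  refine Finset.prod_congr rfl fun k _ => ?_
  -- The first monomial gives the required index directly; for the second, the symmetry f_{-n} = f_n
  -- is needed.
  rw [mul_sub, ← LaurentPolynomial.T_add, ← LaurentPolynomial.T_add, map_sub, sub_mul, map_sub,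
    mapCoeff_C_T_mul, mapCoeff_C_T_mul, ← fCoeff_eq, ← fCoeff_eq, ← fCoeff_neg (_ - (_ + (_ + _)))]
  congr 2 <;> ring

end DualCharacters

/-! ### Hyperoctahedral antisymmetry: the bras determine the evaluation. -/

section Antisymmetry

open scoped nonZeroDivisors

variable {R : Type*} [CommRing R] {l : ℕ}

/-- An element annihilated by 1 - z^a has coefficients invariant under translation by a ≠ 0, which
finite support forbids unless all vanish. The argument needs no domain hypothesis on R. -/
theorem one_sub_single_mem_nonZeroDivisors {a : Fin l → ℤ} (ha : a ≠ 0) :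
    1 - AddMonoidAlgebra.single a (1 : R) ∈ (MvLaurent R l)⁰ := by
  rw [mem_nonZeroDivisors_iff_right]
  intro f hf
  rw [mul_comm, sub_mul, one_mul, sub_eq_zero] at hf
  have hstep : ∀ e, f.coeff e = f.coeff (e - a) := fun e => by
    conv_lhs => rw [hf]
    exact coeff_single_one_mul' a e f
  have hn : ∀ (n : ℕ) e, f.coeff e = f.coeff (e - n • a) := by
    intro n
    induction n with
    | zero => simp
    | succ n ih => intro e; rw [ih, hstep, sub_sub, succ_nsmul]
  by_contra h
  obtain ⟨e, he⟩ : ∃ e, f.coeff e ≠ 0 := by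
    by_contra! h'
    exact h (AddMonoidAlgebra.ext (Finsupp.ext h'))
  have hinj : Function.Injective fun n : ℕ => e - n • a := by
    intro m n hmn
    obtain ⟨i, hi⟩ := Function.ne_iff.1 ha
    have := congrFun hmn i
    simp only [Pi.sub_apply, Pi.smul_apply, sub_right_inj] at this
    rw [nsmul_eq_mul, nsmul_eq_mul] at this
    exact_mod_cast mul_right_cancel₀ hi this
  refine (Set.infinite_of_injective_forall_mem hinj (s := (f.coeff.support : Set (Fin l → ℤ)))
    fun n => ?_) (Finset.finite_toSet _)
  rw [Finset.mem_coe, Finsupp.mem_support_iff, ← hn]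
  exact he

theorem isUnit_mvT (k : ℕ) (n : ℤ) : IsUnit (mvT R l k n) :=
  IsUnit.of_mul_eq_one _ (mvT_mul_neg k n)

/-- The product `∏_k (1 - z_k) ∏_{i < j} (z_i + z_i⁻¹ - z_j - z_j⁻¹)`. -/
def weylProd (R : Type*) [CommRing R] (l : ℕ) : MvLaurent R l :=
  (∏ k ∈ Finset.range l, (1 - mvT R l k 1)) * diffProd (mvSym R l) l

/-- Each Z_i - Z_j is a unit times two factors of the form 1 - monomial. -/
theorem weylProd_mem_nonZeroDivisors : weylProd R l ∈ (MvLaurent R l)⁰ := by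
  refine mul_mem (prod_mem fun k hk => ?_) (prod_mem fun i hi => prod_mem fun j hj => ?_)
  · refine one_sub_single_mem_nonZeroDivisors fun h => ?_
    simpa using congrFun h ⟨k, Finset.mem_range.1 hk⟩
  · rw [Finset.mem_range] at hi
    rw [Finset.mem_Ico] at hj
    have h : mvSym R l i - mvSym R l j = mvT R l i 1 *
        ((1 - mvT R l i (-1) * mvT R l j 1) * (1 - mvT R l i (-1) * mvT R l j (-1))) := by
      have h1 := mvT_mul_neg (R := R) (l := l) i 1
      have h2 := mvT_mul_neg (R := R) (l := l) j 1
      rw [mvSym, mvSym]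
      linear_combination (mvT R l j 1 + mvT R l j (-1) - mvT R l i (-1)) * h1 -
        (mvT R l i (-1) + mvT R l i (-1) * (mvT R l i 1 * mvT R l i (-1) - 1)) * h2
    rw [h]
    refine mul_mem (isUnit_mvT i 1).mem_nonZeroDivisors (mul_mem ?_ ?_) <;>
    · rw [mvT, mvT, AddMonoidAlgebra.single_mul_single, mul_one]
      refine one_sub_single_mem_nonZeroDivisors fun h => ?_
      have h' := congrFun h ⟨i, hi⟩
      have hij : i ≠ j := by omega
      simp [hij] at h'

theorem coeff_prod_mvT_mul (s : Finset ℕ) (a : ℕ → ℤ) (g : MvLaurent R l) (e : Fin l → ℤ) :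
    ((∏ k ∈ s, mvT R l k (a k)) * g).coeff e =
      g.coeff fun i => if (i : ℕ) ∈ s then e i - a i else e i := by
  induction s using Finset.induction_on generalizing e with
  | empty => simp
  | insert k s hk ih =>
    rw [Finset.prod_insert hk, mul_assoc, coeff_mvT_mul, ih]
    congr 1
    funext i
    by_cases h : (i : ℕ) = k
    · subst h; simp [hk]
    · simp [h]

theorem coeff_weylDen_mul (f : MvLaurent R l) (e : Fin l → ℤ) :
    (weylDen R l * f).coeff e = (weylProd R l * f).coeff fun i => e i - (l - 1 - (i : ℕ)) := by
  rw [weylDen, Finset.prod_mul_distrib, mul_comm (∏ k ∈ _, (1 - _)), mul_assoc, mul_assoc,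
    coeff_prod_mvT_mul, weylProd, mul_assoc]
  congr 1
  funext i
  rw [if_pos (Finset.mem_range.2 i.2)]

theorem diffProd_eq_det {A : Type*} [CommRing A] (Z : ℕ → A) :
    diffProd Z l = (Matrix.vandermonde fun i : Fin l => -Z i).det := by
  rw [Matrix.det_vandermonde, diffProd, Finset.prod_range]
  refine Finset.prod_congr rfl fun i _ => ?_
  have h : Finset.Ico ((i : ℕ) + 1) l = (Finset.Ioi i).map Fin.valEmbedding := by
    rw [Fin.map_valEmbedding_Ioi]
    ext j
    simp only [Finset.mem_Ico, Finset.mem_Ioo]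
    omega
  rw [h, Finset.prod_map]
  refine Finset.prod_congr rfl fun j _ => ?_
  simp only [Fin.valEmbedding_apply]
  ring

/-- The permutation `z_k ↦ z_{σ k}` of the variables. -/
def permAut (R : Type*) [CommRing R] (σ : Equiv.Perm (Fin l)) : MvLaurent R l ≃ₐ[R] MvLaurent R l :=
  AddMonoidAlgebra.domCongr R R (AddEquiv.arrowCongr σ (AddEquiv.refl ℤ))

theorem coeff_permAut (σ : Equiv.Perm (Fin l)) (f : MvLaurent R l) (e : Fin l → ℤ) :
    (permAut R σ f).coeff e = f.coeff (e ∘ σ) :=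
  AddMonoidAlgebra.coeff_domCongr _ _ _

theorem permAut_mvT (σ : Equiv.Perm (Fin l)) (k : Fin l) (n : ℤ) :
    permAut R σ (mvT R l k n) = mvT R l (σ k) n := by
  refine (AddMonoidAlgebra.domCongr_single _ _ _).trans ?_
  rw [mvT]
  congr 1
  funext i
  refine if_congr ?_ rfl rfl
  rw [Fin.val_inj, Fin.val_inj]
  exact Equiv.symm_apply_eq σ

/-- The inversion `z_k ↦ z_k⁻¹` of one variable. -/
def invAut (R : Type*) [CommRing R] (k : Fin l) : MvLaurent R l ≃ₐ[R] MvLaurent R l :=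
  AddMonoidAlgebra.domCongr R R
    { toFun := fun e i => if i = k then -e i else e i
      invFun := fun e i => if i = k then -e i else e i
      left_inv := fun e => by funext i; dsimp only; split_ifs <;> simp
      right_inv := fun e => by funext i; dsimp only; split_ifs <;> simp
      map_add' := fun a b => by
        funext i
        simp only [Pi.add_apply]
        split_ifs <;> ring }

theorem coeff_invAut (k : Fin l) (f : MvLaurent R l) (e : Fin l → ℤ) :
    (invAut R k f).coeff e = f.coeff fun i => if i = k then -e i else e i :=
  AddMonoidAlgebra.coeff_domCongr _ _ _

theorem invAut_mvT (k : Fin l) (j : ℕ) (n : ℤ) :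
    invAut R k (mvT R l j n) = mvT R l j (if j = k then -n else n) := by
  refine (AddMonoidAlgebra.domCongr_single _ _ _).trans ?_
  rw [mvT]
  congr 1
  funext i
  change (if i = k then -(if (i : ℕ) = j then n else 0) else if (i : ℕ) = j then n else 0) = _
  by_cases h1 : i = k
  · subst h1
    by_cases h2 : (i : ℕ) = j
    · simp [h2]
    · simp [h2]
  · by_cases h2 : (i : ℕ) = j
    · have : j ≠ k := fun h => h1 (Fin.ext (h2.trans h))
      simp [h1, h2, this]
    · simp [h2]

theorem invAut_mvSym (k : Fin l) (j : ℕ) : invAut R k (mvSym R l j) = mvSym R l j := by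
  rw [mvSym, map_add, invAut_mvT, invAut_mvT]
  split_ifs
  · rw [neg_neg, add_comm]
  · rfl

theorem evSym_invariant (φ : MvLaurent R l →ₐ[R] MvLaurent R l)
    (h : ∀ n : ℕ+, φ (∑ k ∈ Finset.range l, (mvT R l k (n : ℕ) + mvT R l k (-(n : ℕ)))) =
      ∑ k ∈ Finset.range l, (mvT R l k (n : ℕ) + mvT R l k (-(n : ℕ)))) (u : Fock R) :
    φ (evSym R l u) = evSym R l u := by
  have : φ.comp (evSym R l) = evSym R l := by
    refine MvPolynomial.algHom_ext fun n => ?_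
    rw [AlgHom.comp_apply, evSym_X, h]
  exact DFunLike.congr_fun this u

theorem permAut_evSym (σ : Equiv.Perm (Fin l)) (u : Fock R) :
    permAut R σ (evSym R l u) = evSym R l u := by
  refine evSym_invariant (permAut R σ : MvLaurent R l →ₐ[R] MvLaurent R l) (fun n => ?_) u
  rw [Finset.sum_range, map_sum,
    ← Equiv.sum_comp σ fun k : Fin l => mvT R l k (n : ℕ) + mvT R l k (-(n : ℕ))]
  refine Finset.sum_congr rfl fun k _ => ?_
  simp [permAut_mvT]

theorem invAut_evSym (k : Fin l) (u : Fock R) : invAut R k (evSym R l u) = evSym R l u := by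
  refine evSym_invariant (invAut R k : MvLaurent R l →ₐ[R] MvLaurent R l) (fun n => ?_) u
  rw [map_sum]
  refine Finset.sum_congr rfl fun j _ => ?_
  simp only [AlgEquiv.coe_toAlgHom, map_add, invAut_mvT]
  split_ifs
  · rw [neg_neg, add_comm]
  · rfl

theorem permAut_weylProd (σ : Equiv.Perm (Fin l)) :
    permAut R σ (weylProd R l) = (Equiv.Perm.sign σ : ℤ) • weylProd R l := by
  rw [weylProd, map_mul, Finset.prod_range, map_prod]
  have h1 : ∏ k : Fin l, permAut R σ (1 - mvT R l k 1) = ∏ k : Fin l, (1 - mvT R l k 1) := by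
    rw [← Equiv.prod_comp σ fun k : Fin l => 1 - mvT R l k 1]
    refine Finset.prod_congr rfl fun k _ => ?_
    rw [map_sub, map_one, permAut_mvT]
  have h2 : permAut R σ (diffProd (mvSym R l) l) =
      (Equiv.Perm.sign σ : ℤ) • diffProd (mvSym R l) l := by
    rw [diffProd_eq_det, zsmul_eq_mul, ← Matrix.det_permute]
    refine ((permAut R σ).toRingEquiv.toRingHom.map_det _).trans ?_
    congr 1
    ext1 i j
    simp only [RingHom.mapMatrix_apply, Matrix.map_apply, Matrix.vandermonde_apply,
      Matrix.submatrix_apply, id_eq, map_pow, map_neg]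
    congr 2
    change permAut R σ (mvSym R l i) = _
    rw [mvSym, map_add, permAut_mvT, permAut_mvT, mvSym]
  rw [h1, h2, mul_smul_comm]

theorem invAut_weylProd (k : Fin l) :
    invAut R k (weylProd R l) = -(mvT R l k (-1) * weylProd R l) := by
  have h1 : invAut R k (diffProd (mvSym R l) l) = diffProd (mvSym R l) l := by
    have := map_diffProd (invAut R k).toRingEquiv.toRingHom (mvSym R l) l
    refine this.trans ?_
    congr 1
    funext j
    exact invAut_mvSym k j
  have hk : (k : ℕ) ∈ Finset.range l := Finset.mem_range.2 k.2
  rw [weylProd, map_mul, h1, map_prod, ← Finset.mul_prod_erase _ _ hk,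
    ← Finset.mul_prod_erase _ _ hk]
  have h2 : ∏ j ∈ (Finset.range l).erase k, invAut R k (1 - mvT R l j 1) =
      ∏ j ∈ (Finset.range l).erase k, (1 - mvT R l j 1) := by
    refine Finset.prod_congr rfl fun j hj => ?_
    rw [map_sub, map_one, invAut_mvT, if_neg (Finset.mem_erase.1 hj).1]
  rw [h2, map_sub, map_one, invAut_mvT, if_pos rfl]
  have h3 := mvT_mul_neg (R := R) (l := l) k 1
  linear_combination (-(∏ j ∈ (Finset.range l).erase k, (1 - mvT R l j 1)) *
    diffProd (mvSym R l) l) * h3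

theorem coeff_comp_perm (σ : Equiv.Perm (Fin l)) (u : Fock R) (e : Fin l → ℤ) :
    (weylProd R l * evSym R l u).coeff (e ∘ σ) =
      (Equiv.Perm.sign σ : ℤ) • (weylProd R l * evSym R l u).coeff e := by
  rw [← coeff_permAut, map_mul, permAut_evSym, permAut_weylProd, smul_mul_assoc]
  rfl

/-- Inverting z_k multiplies 1 - z_k by -z_k⁻¹ and fixes the other factors, so the reflection of
exponents is centred at 1/2. -/
theorem coeff_reflect (k : Fin l) (u : Fock R) (e : Fin l → ℤ) :
    (weylProd R l * evSym R l u).coeff (fun i => if i = k then 1 - e i else e i) =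
      -(weylProd R l * evSym R l u).coeff e := by
  have h := coeff_invAut k (weylProd R l * evSym R l u) fun i => if i = k then e i - 1 else e i
  rw [map_mul, invAut_evSym, invAut_weylProd, neg_mul, mul_assoc, AddMonoidAlgebra.coeff_neg,
    Finsupp.neg_apply, coeff_mvT_mul] at h
  have e1 : (fun i : Fin l => if (i : ℕ) = k then (if i = k then e i - 1 else e i) - -1
      else if i = k then e i - 1 else e i) = e := by
    funext i
    by_cases hi : i = k
    · simp [hi]
    · simp [hi, Fin.val_inj]
  rw [e1] at h
  rw [h]
  congr 1
  funext i
  split_ifs <;> ring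

variable [Algebra ℚ R]

theorem eq_zero_of_eq_neg {r : R} (h : r = -r) : r = 0 := by
  have h2 : (2 : ℚ) • r = 0 := by
    rw [two_smul]
    nth_rewrite 1 [h]
    exact neg_add_cancel r
  have := congrArg (fun t => (2⁻¹ : ℚ) • t) h2
  simpa [smul_smul] using this

/-- The bras read the coefficients at the exponents -rho_i - (l - 1 - i), counting i from 0; these
are exactly the strictly increasing nonpositive vectors, a set of representatives for the vectors
not forced to vanish by antisymmetry. Then `weylProd` is cancelled. -/
theorem evSym_eq_zero_of_bra {u : Fock R} (h : ∀ rho : GenPartition l, bra rho u = 0) :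
    evSym R l u = 0 := by
  set g := weylProd R l * evSym R l u with hg
  have hdom : ∀ e : Fin l → ℤ, StrictMono e → (∀ i, e i ≤ 0) → g.coeff e = 0 := by
    intro e hmono hneg
    have hgap : ∀ i j : Fin l, i ≤ j → e i + ((j : ℕ) - (i : ℕ) : ℤ) ≤ e j := by
      intro i j hij
      obtain ⟨d, hd⟩ : ∃ d : ℕ, (j : ℕ) = i + d := ⟨j - i, by have := Fin.le_def.1 hij; omega⟩
      induction d generalizing j with
      | zero =>
        obtain rfl : j = i := Fin.ext hd
        simp
      | succ d ih =>
        have h1 := ih ⟨i + d, by have := j.2; omega⟩ (Fin.le_def.2 (by simp)) rfl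
        have h2 : e ⟨i + d, by have := j.2; omega⟩ < e j := hmono (Fin.lt_def.2 (by simp [hd]))
        simp only at h1
        omega
    have hlast : ∀ i : Fin l, e i + (l - 1 - (i : ℕ)) ≤ 0 := by
      intro i
      have hi := i.2
      have h1 := hgap i ⟨l - 1, by omega⟩ (Fin.le_def.2 (by simp only; omega))
      have h2 := hneg ⟨l - 1, by omega⟩
      simp only at h1
      omega
    have hanti : Antitone fun i : Fin l => (-e i - (l - 1 - (i : ℕ))).toNat := by
      intro i j hij
      have h1 := hgap i j hij
      have h2 := hlast i
      have h3 := hlast j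
      simp only
      omega
    have h1 := h ⟨_, hanti⟩
    rw [bra_eq_coeff, coeff_weylDen_mul] at h1
    rw [← h1]
    congr 1
    funext i
    have h2 := hlast i
    simp only
    omega
  have hneg : ∀ e : Fin l → ℤ, (∀ i, e i ≤ 0) → g.coeff e = 0 := by
    intro e he
    by_cases hinj : Function.Injective e
    · have h1 := coeff_comp_perm (Tuple.sort e) u e
      rw [← hg, hdom _ ((Tuple.monotone_sort e).strictMono_of_injective
        (hinj.comp (Tuple.sort e).injective)) fun i => he _] at h1
      rcases Int.units_eq_one_or (Equiv.Perm.sign (Tuple.sort e)) with hs | hs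
      · rw [hs] at h1
        simpa using h1.symm
      · rw [hs] at h1
        simpa using h1.symm
    -- With a repeated exponent, a transposition shows that the coefficient is its own negative, and
    -- 2 is invertible.
    · obtain ⟨i, j, hij, hne⟩ : ∃ i j, e i = e j ∧ i ≠ j := by
        simpa [Function.Injective] using hinj
      have h1 := coeff_comp_perm (Equiv.swap i j) u e
      have h2 : e ∘ Equiv.swap i j = e := by
        funext k
        rw [Function.comp_apply, Equiv.swap_apply_def]
        split_ifs with h3 h4
        · rw [h3, hij]
        · rw [h4, hij]
        · rfl
      rw [h2, Equiv.Perm.sign_swap hne] at h1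
      exact eq_zero_of_eq_neg (by simpa using h1)
  -- Positive exponents are reflected one at a time: e_k ≥ 1 gives 1 - e_k ≤ 0. The set s bounds the
  -- indices still to be treated.
  have hall : ∀ (s : Finset (Fin l)) (e : Fin l → ℤ), (∀ i, 0 < e i → i ∈ s) →
      g.coeff e = 0 := by
    intro s
    induction s using Finset.induction_on with
    | empty => exact fun e he => hneg e fun i => not_lt.1 fun hi => by simpa using he i hi
    | insert k s hk ih =>
      intro e he
      by_cases hpos : 0 < e k
      · have h1 := coeff_reflect k u e
        rw [← hg, ih] at h1
        · exact neg_eq_zero.1 h1.symm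
        · intro i hi
          by_cases hik : i = k
          · subst hik
            rw [if_pos rfl] at hi
            omega
          · rw [if_neg hik] at hi
            exact (Finset.mem_insert.1 (he i hi)).resolve_left hik
      · refine ih e fun i hi => (Finset.mem_insert.1 (he i hi)).resolve_left ?_
        rintro rfl
        exact hpos hi
  have hg0 : g = 0 := AddMonoidAlgebra.ext
    (Finsupp.ext fun e => hall Finset.univ e fun i _ => Finset.mem_univ i)
  exact (mem_nonZeroDivisors_iff_right.1 (weylProd_mem_nonZeroDivisors (R := R) (l := l))) _
    (by rw [mul_comm, ← hg, hg0])

end Antisymmetry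

/-! ### Orthonormality, completeness and commutation of Γ_+ with Γ_-. -/

section Completeness

variable {R : Type*} [CommRing R] {l N K : ℕ}

/-- The specialization of the last `N` variables at units. -/
def specialize (l : ℕ) (x : Fin N → Rˣ) : MvLaurent R (l + N) →ₐ[R] MvLaurent R l :=
  AddMonoidAlgebra.lift R (MvLaurent R l) (Fin (l + N) → ℤ)
    { toFun := fun e => AddMonoidAlgebra.single (fun i => e.toAdd (Fin.castAdd N i))
        ((∏ i, x i ^ (e.toAdd (Fin.natAdd l i)) : Rˣ) : R)
      map_one' := by simp [AddMonoidAlgebra.one_def, Pi.zero_def]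
      map_mul' := fun a b => by
        rw [AddMonoidAlgebra.single_mul_single, ← Units.val_mul, ← Finset.prod_mul_distrib]
        simp only [toAdd_mul, Pi.add_apply, zpow_add]
        rfl }

theorem specialize_single (x : Fin N → Rˣ) (e : Fin (l + N) → ℤ) :
    specialize l x (AddMonoidAlgebra.single e 1) =
      AddMonoidAlgebra.single (fun i => e (Fin.castAdd N i))
        ((∏ i, x i ^ (e (Fin.natAdd l i)) : Rˣ) : R) :=
  (AddMonoidAlgebra.lift_single _ _ _).trans (one_smul _ _)

theorem specialize_mvT_castAdd (x : Fin N → Rˣ) (k : Fin l) (n : ℤ) :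
    specialize l x (mvT R (l + N) k n) = mvT R l k n := by
  rw [mvT, specialize_single, mvT]
  congr 1
  rw [Finset.prod_eq_one, Units.val_one]
  intro i _
  have h : l + (i : ℕ) ≠ k := by have := k.2; omega
  simp [h]

theorem specialize_mvT_natAdd (x : Fin N → Rˣ) (k : Fin N) (n : ℤ) :
    specialize l x (mvT R (l + N) (l + k) n) = algebraMap R _ ((x k ^ n : Rˣ) : R) := by
  rw [mvT, specialize_single]
  have h1 : (fun i : Fin l => if ((Fin.castAdd N i : Fin (l + N)) : ℕ) = l + k then n else 0) =
      0 := by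
    funext i
    have h : ((Fin.castAdd N i : Fin (l + N)) : ℕ) ≠ l + k := by
      have := i.2
      simp only [Fin.val_castAdd]
      omega
    rw [if_neg h, Pi.zero_apply]
  rw [h1, Finset.prod_eq_single k]
  · simp
  · intro i _ hi
    have h : (i : ℕ) ≠ k := fun h => hi (Fin.ext h)
    simp [h]
  · simp

/-- Both sides add the power sums of x^± to those of z_1^±, ..., z_l^±. Hence Γ_+(x^±) followed by
evaluation in l variables kills the kernel of evaluation in l + N variables. -/
theorem evSym_gammaPlus (x : Fin N → Rˣ) (u : Fock R) :
    evSym R l (gammaPlus x u) = specialize l x (evSym R (l + N) u) := by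
  have h : (evSym R l).comp (gammaPlus x) = (specialize l x).comp (evSym R (l + N)) := by
    refine MvPolynomial.algHom_ext fun n => ?_
    rw [AlgHom.comp_apply, AlgHom.comp_apply, gammaPlus_X, map_add, evSym_X, evSym_X,
      Finset.sum_range, Finset.sum_range, Fin.sum_univ_add,
      ← MvPolynomial.algebraMap_eq, AlgHom.commutes, map_add, map_sum, map_sum, map_sum]
    congr 1
    · refine Finset.sum_congr rfl fun k _ => ?_
      rw [map_add, Fin.val_castAdd, specialize_mvT_castAdd, specialize_mvT_castAdd]
    · refine Finset.sum_congr rfl fun k _ => ?_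
      rw [map_add, map_add, Fin.val_natAdd, specialize_mvT_natAdd, specialize_mvT_natAdd]
      simp
  exact DFunLike.congr_fun h u

theorem gammaPlus_fin_zero (x : Fin 0 → Rˣ) (v : Fock R) : gammaPlus x v = v := by
  have h : gammaPlus x = AlgHom.id R (Fock R) := by
    refine MvPolynomial.algHom_ext fun n => ?_
    rw [gammaPlus_X]
    simp
  rw [h]
  rfl

/-- Without x the series is 1 and the entries compare lam_i - i with mu_j - j. Both sequences
strictly decrease, so a permutation with nonzero Leibniz term is increasing, hence trivial, and
forces lam = mu. -/
theorem skewSO_zero (x : Fin 0 → Rˣ) (lam mu : GenPartition l) :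
    skewSO (l := l) (N := 0) x lam mu = if lam = mu then 1 else 0 := by
  have hH : hSeries x = 1 := by simp [hSeries]
  have h1 : skewSO (l := l) (N := 0) x lam mu = (Matrix.of fun i j : Fin l =>
      if (lam.1 i : ℤ) - (i : ℕ) = (mu.1 j : ℤ) - (j : ℕ) then (1 : R) else 0).det := by
    rw [skewSO]
    congr 1
    ext i j
    simp only [Matrix.of_apply]
    rw [dif_pos (show (j : ℕ) < l from j.2), hPM_eq, hH, zcoeff_one]
    refine if_congr ?_ rfl rfl
    constructor <;> intro h <;> simp only [Fin.eta] at h ⊢ <;> omega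
  have hlt : ∀ (p : GenPartition l) {i j : Fin l}, i < j →
      (p.1 j : ℤ) - (j : ℕ) < (p.1 i : ℤ) - (i : ℕ) := by
    intro p i j hij
    have := p.2 hij.le
    have := Fin.lt_def.1 hij
    omega
  have hlt_iff : ∀ (p : GenPartition l) {i j : Fin l},
      (p.1 j : ℤ) - (j : ℕ) < (p.1 i : ℤ) - (i : ℕ) → i < j := by
    intro p i j h
    rcases lt_trichotomy i j with h1 | rfl | h1
    · exact h1
    · exact absurd h (lt_irrefl _)
    · exact absurd h (lt_asymm (hlt p h1))
  rw [h1]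
  split_ifs with h
  · subst h
    have h2 : (Matrix.of fun i j : Fin l =>
        if (lam.1 i : ℤ) - (i : ℕ) = (lam.1 j : ℤ) - (j : ℕ) then (1 : R) else 0) = 1 := by
      ext i j
      rw [Matrix.of_apply, Matrix.one_apply]
      refine if_congr ⟨fun h => ?_, fun h => by rw [h]⟩ rfl rfl
      rcases lt_trichotomy i j with h3 | h3 | h3
      · exact absurd h (hlt lam h3).ne'
      · exact h3
      · exact absurd h (hlt lam h3).ne
    rw [h2, Matrix.det_one]
  · rw [Matrix.det_apply]
    refine Finset.sum_eq_zero fun σ _ => ?_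
    suffices hz : ∃ j, ¬ ((lam.1 (σ j) : ℤ) - (σ j : ℕ) = (mu.1 j : ℤ) - (j : ℕ)) by
      obtain ⟨j, hj⟩ := hz
      rw [Finset.prod_eq_zero (Finset.mem_univ j), smul_zero]
      exact if_neg hj
    by_contra! hall
    have hmono : StrictMono σ := fun i j hij => hlt_iff lam (by
      rw [hall, hall]
      exact hlt mu hij)
    have hσ : (σ : Fin l → Fin l) = id :=
      (StrictMono.range_inj hmono strictMono_id).1 (by simp [σ.surjective.range_eq])
    refine h (Subtype.ext (funext fun j => ?_))
    have := hall j
    rw [hσ] at this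
    simp only [id_eq] at this
    omega

variable [Algebra ℚ R]

/-- The functional `bra mu` as a linear map. -/
def braLin (mu : GenPartition l) : Fock R →ₗ[R] R :=
  mvCoeff (fun k => -(mu.1 k : ℤ)) ∘ₗ LinearMap.mulLeft R (weylDen R l) ∘ₗ
    (evSym R l).toLinearMap

theorem bra_eq_braLin (mu : GenPartition l) (v : Fock R) : bra mu v = braLin mu v :=
  bra_eq_coeff mu v

theorem bra_eq_zero {mu : GenPartition l} {v : Fock R} (h : evSym R l v = 0) : bra mu v = 0 := by
  rw [bra_eq_coeff, h, mul_zero]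
  rfl

/-- The values are coefficients of a single Laurent polynomial at distinct exponents. -/
theorem finite_bra_ne_zero (v : Fock R) : {rho : GenPartition l | bra rho v ≠ 0}.Finite := by
  refine Set.Finite.of_finite_image
    (f := fun rho : GenPartition l => fun k => -(rho.1 k : ℤ)) ?_ ?_
  · refine (Finset.finite_toSet (weylDen R l * evSym R l v).coeff.support).subset ?_
    rintro _ ⟨rho, hrho, rfl⟩
    rw [Finset.mem_coe, Finsupp.mem_support_iff, ← bra_eq_coeff]
    exact hrho
  · intro a _ b _ hab
    refine Subtype.ext (funext fun k => ?_)
    have := congrFun hab k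
    simpa using this

theorem bra_ket (mu lam : GenPartition l) :
    bra (R := R) mu (ket lam) = if lam = mu then 1 else 0 := by
  have h := gammaPlusCoeff_eq_skewSO (R := R) (l := l) (N := 0) Fin.elim0 mu lam
  rw [skewSO_zero, gammaPlusCoeff, gammaPlus_fin_zero] at h
  exact h

/-- By orthonormality every bra vanishes on the difference of the two vectors. -/
theorem evSym_eq_sum_ket (v : Fock R) : evSym R l v =
    evSym R l (∑ rho ∈ (finite_bra_ne_zero (l := l) v).toFinset, bra rho v • ket rho) := by
  rw [← sub_eq_zero, ← map_sub]
  refine evSym_eq_zero_of_bra fun mu => ?_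
  rw [bra_eq_braLin, map_sub, map_sum]
  simp only [map_smul, ← bra_eq_braLin, bra_ket, smul_eq_mul, mul_ite, mul_one, mul_zero,
    Finset.sum_ite_eq', Set.Finite.mem_toFinset, Set.mem_ofPred_eq]
  split_ifs with h
  · exact sub_self _
  · rw [sub_zero]
    simpa using h

/-- The completeness relation: `∑_rho |rho⟩⟨rho|` acts as the identity in front of functionals that
factor through the evaluation at finitely many variables. -/
theorem finsum_bra_mul (φ : Fock R →ₗ[R] R) (hφ : ∀ u, evSym R l u = 0 → φ u = 0) (v : Fock R) :
    {rho : GenPartition l | bra rho v * φ (ket rho) ≠ 0}.Finite ∧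
      ∑ᶠ rho : GenPartition l, bra rho v * φ (ket rho) = φ v := by
  have hsub : {rho : GenPartition l | bra rho v * φ (ket rho) ≠ 0} ⊆
      {rho : GenPartition l | bra rho v ≠ 0} := fun rho h => left_ne_zero_of_mul h
  refine ⟨(finite_bra_ne_zero v).subset hsub, ?_⟩
  rw [finsum_eq_sum_of_support_subset (s := (finite_bra_ne_zero (l := l) v).toFinset) _
    (by rw [Set.Finite.coe_toFinset]; exact hsub)]
  have h := hφ (v - ∑ rho ∈ (finite_bra_ne_zero (l := l) v).toFinset, bra rho v • ket rho)
    (by rw [map_sub, sub_eq_zero]; exact evSym_eq_sum_ket v)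
  rw [map_sub, sub_eq_zero, map_sum] at h
  rw [h]
  exact Finset.sum_congr rfl fun rho _ => (by rw [map_smul, smul_eq_mul])

/-- The relation Γ_+(x^±) Γ_-(y) = kernel · Γ_-(y) Γ_+(x^±), read on the coefficient of y^d: Γ_+ is
an algebra homomorphism that multiplies each Γ_-(y_j) by the series of the h_n at y_j. -/
theorem gammaPlus_creationMonomial (x : Fin N → Rˣ) (d : Fin K →₀ ℕ) :
    gammaPlus x (creationMonomial R d) = ∑ p ∈ Finset.HasAntidiagonal.antidiagonal d,
      MvPowerSeries.coeff p.1 (cauchyKernel K x) • creationMonomial R p.2 := by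
  refine (map_creationMonomial (gammaPlus x).toRingHom d).trans ?_
  rw [map_gammaPlus_creationExp, coeff_prodSeries]
  simp only [mul_comm (creationExp R)]
  rw [prod_coeff_mul]
  refine Finset.sum_congr rfl fun p _ => ?_
  rw [cauchyKernel_eq, coeff_prodSeries, creationMonomial_eq, coeff_prodSeries,
    MvPolynomial.smul_eq_C_mul, map_prod]
  simp only [PowerSeries.coeff_map]

/-- The power series whose coefficients are the matrix coefficients of
`creationMonomial d * Γ_+(x^±)`. -/
def mixedCoeff {m : ℕ} (K : ℕ) (x : Fin N → Rˣ) (mu : GenPartition l) (lam : GenPartition m) :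
    MvPowerSeries (Fin K) R :=
  fun d => bra mu (creationMonomial R d * gammaPlus x (ket lam))

theorem coeff_mixedCoeff {m : ℕ} (x : Fin N → Rˣ) (mu : GenPartition l) (lam : GenPartition m)
    (d : Fin K →₀ ℕ) : MvPowerSeries.coeff d (mixedCoeff K x mu lam) =
      bra mu (creationMonomial R d * gammaPlus x (ket lam)) := rfl

end Completeness

end OddOrth

end

open OddOrth in
theorem mainTheorem3 {R : Type*} [CommRing R] [Algebra ℚ R] (l N K : ℕ) (x : Fin N → Rˣ)
    (mu : GenPartition l) (lam : GenPartition (l + N)) :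
    -- matrix coefficients of the half vertex operators
    (∀ (rho : GenPartition (l + N)) (tau : GenPartition l),
      gammaPlusCoeff x tau rho = skewSO x rho tau) ∧
    (∀ (n : ℕ) (alpha beta : GenPartition n),
      gammaMinusCoeff R K alpha beta = dualSO R K alpha beta) ∧
    -- the Cauchy-type identity
    ∃ S : MvPowerSeries (Fin K) R,
      HasFormalSum (fun tau : GenPartition l =>
        MvPowerSeries.C (skewSO x lam tau) * dualSO R K mu tau) S ∧
      HasFormalSum (fun rho : GenPartition (l + N) =>
        MvPowerSeries.C (skewSO x rho mu) * dualSO R K rho lam) (cauchyKernel K x * S) := by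
  refine ⟨fun rho tau => gammaPlusCoeff_eq_skewSO x tau rho,
    fun n alpha beta => gammaMinusCoeff_eq_dualSO alpha beta,
    mixedCoeff K x mu lam, fun d => ?_, fun d => ?_⟩
  -- Completeness with l entries, inserted between Γ_-(y) and Γ_+(x^±).
  · have h := finsum_bra_mul (l := l) (braLin mu ∘ₗ LinearMap.mulLeft R (creationMonomial R d))
      (fun u hu => by
        rw [LinearMap.comp_apply, LinearMap.mulLeft_apply, ← bra_eq_braLin]
        exact bra_eq_zero (by rw [map_mul, hu, mul_zero])) (gammaPlus x (ket lam))
    have hterm : ∀ tau : GenPartition l, MvPowerSeries.coeff d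
        (MvPowerSeries.C (skewSO x lam tau) * dualSO R K mu tau) =
        bra tau (gammaPlus x (ket lam)) *
          (braLin mu ∘ₗ LinearMap.mulLeft R (creationMonomial R d)) (ket tau) := by
      intro tau
      rw [MvPowerSeries.coeff_C_mul, ← gammaPlusCoeff_eq_skewSO, ← gammaMinusCoeff_eq_dualSO,
        coeff_gammaMinusCoeff, bra_eq_braLin mu]
      rfl
    simp only [hterm]
    refine ⟨h.1, h.2.trans ?_⟩
    rw [coeff_mixedCoeff, bra_eq_braLin]
    rfl
  -- Completeness with l + N entries, inserted between Γ_+(x^±) and Γ_-(y); commuting the two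
  -- afterwards produces the kernel.
  · have h := finsum_bra_mul (l := l + N) (braLin mu ∘ₗ (gammaPlus x).toLinearMap)
      (fun u hu => by
        rw [LinearMap.comp_apply, AlgHom.toLinearMap_apply, ← bra_eq_braLin]
        exact bra_eq_zero (by rw [evSym_gammaPlus, hu, map_zero])) (creationMonomial R d * ket lam)
    have hterm : ∀ rho : GenPartition (l + N), MvPowerSeries.coeff d
        (MvPowerSeries.C (skewSO x rho mu) * dualSO R K rho lam) =
        bra rho (creationMonomial R d * ket lam) *
          (braLin mu ∘ₗ (gammaPlus x).toLinearMap) (ket rho) := by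
      intro rho
      rw [MvPowerSeries.coeff_C_mul, ← gammaPlusCoeff_eq_skewSO, ← gammaMinusCoeff_eq_dualSO,
        coeff_gammaMinusCoeff, gammaPlusCoeff, bra_eq_braLin mu, mul_comm]
      rfl
    simp only [hterm]
    refine ⟨h.1, h.2.trans ?_⟩
    classical
    rw [LinearMap.comp_apply, AlgHom.toLinearMap_apply, map_mul, gammaPlus_creationMonomial,
      MvPowerSeries.coeff_mul, Finset.sum_mul, map_sum]
    refine Finset.sum_congr rfl fun p _ => ?_
    rw [smul_mul_assoc, map_smul, smul_eq_mul, ← bra_eq_braLin, coeff_mixedCoeff]
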